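/- Let $n\ge 0$ and let $u,p_{ij},q_{ij}\in\mathbb C$ ($1\le i,j\le n$) satisfy $u\ne 0$, $u^2\ne\pm1$, $p_{ij}q_{ij}=u^2$ for $i<j$, and $p_{ij}p_{ji}=q_{ij}q_{ji}=1$, $p_{ii}=q_{ii}=1$ for all $i,j$. Put $$R=u\sum_i e_{ii}\otimes e_{ii}+u^{-1}\sum_{i>j}p_{ji}\,e_{ii}\otimes e_{jj}+u^{-1}\sum_{i<j}q_{ij}\,e_{ii}\otimes e_{jj}+(u-u^{-1})\sum_{i>j}e_{ij}\otimes e_{ji},$$ $R^+=PRP$ ($P$ the flip of $\mathbb C^n\otimes\mathbb C^n$) and $R^-=R^{-1}$. For a matrix $r=(r_{ij})$ of nonzero scalars and $\sigma\in S_n$ let $(-r)_\sigma=\prod_{i<j,\ \sigma_i>\sigma_j}(-r_{\sigma_j\sigma_i})$, and for an $n\times n$ matrix $X$ over an associative algebra let $\mathrm{rdet}_r(X)=\sum_{\sigma\in S_n}(-r)_\sigma X_{1\sigma_1}\cdots X_{n\sigma_n}$. Let $\mathrm{GL}_{p,u}(n)$ be the algebra generated by the entries of $T=(t_{ij})_{1\le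 i,j\le n}$ subject to $RT_1T_2=T_2T_1R$, with $\det_q(T)=\mathrm{rdet}_q(T)$ inverted; it is a Hopf algebra with $\Delta(t_{ij})=\sum_k t_{ik}\otimes t_{kj}$ and antipode satisfying $S(T)=T^{-1}$. Write $\det_p(T)=\sum_{\sigma\in S_n}(-p)_\sigma t_{\sigma_1 1}\cdots t_{\sigma_n n}$ (which is equal to $\det_q(T)$). Let $l^\pm_{ij}$ be the linear functionals on $\mathrm{GL}_{p,u}(n)$ determined by $(l^{\pm}_{ij},1)=\delta_{ij}$, $(l^\pm_{ij},\varphi\psi)=\sum_k(l^\pm_{ik},\varphi)(l^\pm_{kj},\psi)$ and $(L^\pm_1,T_2)=R^\pm$ (that is, $(l^\pm_{kl},t_{ij})$ is the coefficient of $e_{kl}\otimes e_{ij}$ in $R^\pm$), acting on $\mathrm{GL}_{p,u}(n)$ from the left by $a.\varphi=(\mathrm{id}\otimes a)\Delta(\varphi)$. For $x\in\mathbb C\setminus\{0\}$ let $L(x)=xL^+-x^{-1}L^-$, and let $\partial(x)=(\partial_{ij}(x))$ be the matrix of linear operators on $\mathrm{GL}_{p,u}(n)$ defined by $(u-u^{-1})\,\partial(x)^t\varphi=(L(x).\varphi)\,S(T)$,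 i.e. $$\partial_{ij}(x)\varphi=(u-u^{-1})^{-1}\sum_k\bigl(L_{jk}(x).\varphi\bigr)S(t_{ki}).$$ Set $$\alpha_k=u^{2-n}\prod_{j<k}q_{jk}\prod_{j>k}p_{kj},\qquad \beta_k=u^{n-2}\prod_{j<k}p_{jk}^{-1}\prod_{j>k}q_{kj}^{-1},\qquad \gamma_{k,s}(x)=x\alpha_k^s-x^{-1}\beta_k^s .$$ Then for every $x\in\mathbb C\setminus\{0\}$ and every integer $s\ge 0$, $$\mathrm{rdet}_{p^{-1}}(\partial(x))\,\bigl(\det\nolimits_p(T)^s\bigr)=(u-u^{-1})^{-n}\prod_{i<j}p_{ij}^{-1}\ \prod_{i=1}^n\gamma_{i,s}(xu^{n-i})\ \det\nolimits_q(T)^{s-1},$$ where $\mathrm{rdet}_{p^{-1}}$ is formed with the parameters $p_{ij}^{-1}$ and with composition of operators as product. -/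

import Mathlib

open scoped TensorProduct Kronecker

/-- The weight `(-q)_σ = (-1)^{l(σ)} ∏_{i < j, σ i > σ j} q_{σ j, σ i}` of a permutation. -/
noncomputable def qSign {n : ℕ} (q : Fin n → Fin n → ℂ) (σ : Equiv.Perm (Fin n)) : ℂ :=
  ∏ ij : Fin n × Fin n with ij.1 < ij.2 ∧ σ ij.2 < σ ij.1, -q (σ ij.2) (σ ij.1)

section Determinants

variable {n : ℕ} {A : Type*} [Ring A] [Algebra ℂ A]

/-- Row determinant `∑_σ (-q)_σ X_{1,σ 1} ⋯ X_{n,σ n}`, the factors in this order. -/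
noncomputable def rdet (q : Fin n → Fin n → ℂ) (X : Matrix (Fin n) (Fin n) A) : A :=
  ∑ σ : Equiv.Perm (Fin n), qSign q σ • (List.ofFn fun i => X i (σ i)).prod

/-- Column determinant `∑_σ (-p)_σ X_{σ 1,1} ⋯ X_{σ n,n}`, the factors in this order. -/
noncomputable def cdet (p : Fin n → Fin n → ℂ) (X : Matrix (Fin n) (Fin n) A) : A :=
  ∑ σ : Equiv.Perm (Fin n), qSign p σ • (List.ofFn fun i => X (σ i) i).prod

end Determinants

/-! ### Ordered products -/

section Ordered
variable {A : Type*}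

theorem prod_ofFn_sum [Ring A] {ι : Type*} [Fintype ι] [DecidableEq ι] : ∀ {m : ℕ} (X : Fin m → ι → A),
    (List.ofFn fun i => ∑ k, X i k).prod
      = ∑ f : Fin m → ι, (List.ofFn fun i => X i (f i)).prod
  | 0, X => by simp
  | m + 1, X => by
    rw [List.ofFn_succ, List.prod_cons, prod_ofFn_sum (fun i => X i.succ), Finset.sum_mul_sum,
      ← Fintype.sum_prod_type', ← (Fin.consEquiv (fun _ => ι)).sum_comp]
    refine Finset.sum_congr rfl fun a _ => ?_
    simp [List.ofFn_succ, Fin.consEquiv]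

theorem prod_ofFn_mul [Monoid A] : ∀ {m : ℕ} (X Y : Fin m → A), (∀ i j, Commute (X i) (Y j)) →
    (List.ofFn fun i => X i * Y i).prod = (List.ofFn X).prod * (List.ofFn Y).prod
  | 0, X, Y, _ => by simp
  | m + 1, X, Y, h => by
    have h1 : Commute (List.ofFn fun i => X i.succ).prod (Y 0) := by
      refine Commute.list_prod_left _ _ fun x hx => ?_
      obtain ⟨i, rfl⟩ := (List.mem_ofFn' _ _).1 hx
      exact h _ _
    rw [List.ofFn_succ, List.prod_cons,
      prod_ofFn_mul (fun i => X i.succ) (fun i => Y i.succ) (fun i j => h _ _),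
      List.ofFn_succ (f := X), List.ofFn_succ (f := Y), List.prod_cons, List.prod_cons]
    simp only [mul_assoc]
    congr 1
    rw [← mul_assoc, ← h1.eq, mul_assoc]

theorem prod_ofFn_split [Monoid A] {n : ℕ} (m : ℕ) (hm : m + 1 < n) (f : Fin n → A) :
    (List.ofFn f).prod = ((List.ofFn f).take m).prod *
      (f ⟨m, by omega⟩ * f ⟨m + 1, hm⟩) * ((List.ofFn f).drop (m + 2)).prod := by
  conv_lhs => rw [← List.prod_take_mul_prod_drop _ m]
  rw [List.drop_eq_getElem_cons (i := m) (by simp; omega),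
    List.drop_eq_getElem_cons (i := m + 1) (by simp; omega)]
  simp [mul_assoc]

theorem take_ofFn_congr {n : ℕ} (m : ℕ) (f g : Fin n → A)
    (h : ∀ i : Fin n, (i : ℕ) < m → f i = g i) :
    (List.ofFn f).take m = (List.ofFn g).take m := by
  apply List.ext_getElem
  · simp
  · intro i h1 h2
    simp at h1 ⊢
    exact h _ (by simp; omega)

theorem drop_ofFn_congr {n : ℕ} (m : ℕ) (f g : Fin n → A)
    (h : ∀ i : Fin n, m ≤ (i : ℕ) → f i = g i) :
    (List.ofFn f).drop m = (List.ofFn g).drop m := by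
  apply List.ext_getElem
  · simp
  · intro i h1 h2
    simp at h1 ⊢
    exact h _ (by simp)
end Ordered

/-- The parameters `p_{ij}, q_{ij}, u`, with `p_ij q_ij = u²` for `i < j`, extended to all indices by
`p_ij p_ji = q_ij q_ji = 1`, `p_ii = q_ii = 1`. -/
structure MultiParam (n : ℕ) where
  u : ℂ
  p : Fin n → Fin n → ℂ
  q : Fin n → Fin n → ℂ
  u_ne_zero : u ≠ 0
  u_sq_ne : u ^ 2 ≠ -1
  p_mul_q : ∀ i j, i < j → p i j * q i j = u ^ 2
  p_mul_p : ∀ i j, p i j * p j i = 1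
  q_mul_q : ∀ i j, q i j * q j i = 1
  p_self : ∀ i, p i i = 1
  q_self : ∀ i, q i i = 1

namespace MultiParam

variable {n : ℕ} (P : MultiParam n)

/-- Coefficient of `e_ii ⊗ e_jj` in `R`. -/
noncomputable def rDiag (i j : Fin n) : ℂ :=
  if i = j then P.u else if j < i then P.u⁻¹ * P.p j i else P.u⁻¹ * P.q i j

/-- The multiparameter `R`-matrix
`u ∑ e_ii ⊗ e_ii + u⁻¹ ∑_{i>j} p_ji e_ii ⊗ e_jj + u⁻¹ ∑_{i<j} q_ij e_ii ⊗ e_jj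
  + (u - u⁻¹) ∑_{i>j} e_ij ⊗ e_ji`. -/
noncomputable def R : Matrix (Fin n × Fin n) (Fin n × Fin n) ℂ := fun a b =>
  if a = b then P.rDiag a.1 a.2
  else if a = b.swap ∧ a.2 < a.1 then P.u - P.u⁻¹ else 0

/-- `R⁺ = P R P` with `P` the flip. -/
noncomputable def Rplus : Matrix (Fin n × Fin n) (Fin n × Fin n) ℂ :=
  P.R.submatrix Prod.swap Prod.swap

/-- `R⁻ = R⁻¹`. -/
noncomputable def Rminus : Matrix (Fin n × Fin n) (Fin n × Fin n) ℂ := P.R⁻¹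

/-- `R T₁ T₂`, with `T₁ = T ⊗ I`, `T₂ = I ⊗ T`. -/
noncomputable def rttL {A : Type*} [Ring A] [Algebra ℂ A] (T : Matrix (Fin n) (Fin n) A) :
    Matrix (Fin n × Fin n) (Fin n × Fin n) A :=
  P.R.map (algebraMap ℂ A) * (T ⊗ₖ (1 : Matrix (Fin n) (Fin n) A))
    * ((1 : Matrix (Fin n) (Fin n) A) ⊗ₖ T)

/-- `T₂ T₁ R`. -/
noncomputable def rttR {A : Type*} [Ring A] [Algebra ℂ A] (T : Matrix (Fin n) (Fin n) A) :
    Matrix (Fin n × Fin n) (Fin n × Fin n) A :=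
  ((1 : Matrix (Fin n) (Fin n) A) ⊗ₖ T) * (T ⊗ₖ (1 : Matrix (Fin n) (Fin n) A))
    * P.R.map (algebraMap ℂ A)

variable {A : Type*} [Ring A] [Algebra ℂ A]

/-! ### Consequences of the relation `R T₁ T₂ = T₂ T₁ R` -/


theorem rtt_iff (T : Matrix (Fin n) (Fin n) A) : P.rttL T = P.rttR T ↔ ∀ i j k l : Fin n,
    P.rDiag i j • (T i k * T j l) + (if j < i then P.u - P.u⁻¹ else 0) • (T j k * T i l)
      = P.rDiag k l • (T j l * T i k) + (if k < l then P.u - P.u⁻¹ else 0) • (T j k * T i l) := by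
  have h12 : ∀ i j k l : Fin n, ((T ⊗ₖ (1 : Matrix (Fin n) (Fin n) A)) *
      ((1 : Matrix (Fin n) (Fin n) A) ⊗ₖ T)) (i, j) (k, l) = T i k * T j l := by
    intro i j k l
    simp [Matrix.mul_apply, Fintype.sum_prod_type, Matrix.kroneckerMap_apply, Matrix.one_apply]
  have h21 : ∀ i j k l : Fin n, (((1 : Matrix (Fin n) (Fin n) A) ⊗ₖ T) *
      (T ⊗ₖ (1 : Matrix (Fin n) (Fin n) A))) (i, j) (k, l) = T j l * T i k := by
    intro i j k l
    simp [Matrix.mul_apply, Fintype.sum_prod_type, Matrix.kroneckerMap_apply, Matrix.one_apply]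
  have hL : ∀ i j k l : Fin n, (P.R.map (algebraMap ℂ A) *
      ((T ⊗ₖ (1 : Matrix (Fin n) (Fin n) A)) * ((1 : Matrix (Fin n) (Fin n) A) ⊗ₖ T)))
        (i, j) (k, l) = P.rDiag i j • (T i k * T j l)
          + (if j < i then P.u - P.u⁻¹ else 0) • (T j k * T i l) := by
    intro i j k l
    have hR : ∀ b : Fin n × Fin n, P.R (i, j) b = (if b = (i, j) then P.rDiag i j else 0)
        + (if b = (j, i) then (if j < i then P.u - P.u⁻¹ else 0) else 0) := by
      rintro ⟨a, b⟩
      simp only [R, Prod.mk.injEq, Prod.swap_prod_mk]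
      grind
    rw [Matrix.mul_apply]
    simp only [Matrix.map_apply, hR, map_add, add_mul, Finset.sum_add_distrib]
    simp [apply_ite (algebraMap ℂ A), ite_mul, h12, Algebra.smul_def]
  have hRt : ∀ i j k l : Fin n, (((1 : Matrix (Fin n) (Fin n) A) ⊗ₖ T) *
      (T ⊗ₖ (1 : Matrix (Fin n) (Fin n) A)) * P.R.map (algebraMap ℂ A))
        (i, j) (k, l) = P.rDiag k l • (T j l * T i k)
          + (if k < l then P.u - P.u⁻¹ else 0) • (T j k * T i l) := by
    intro i j k l
    have hR : ∀ b : Fin n × Fin n, P.R b (k, l) = (if b = (k, l) then P.rDiag k l else 0)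
        + (if b = (l, k) then (if k < l then P.u - P.u⁻¹ else 0) else 0) := by
      rintro ⟨a, b⟩
      simp only [R, Prod.mk.injEq, Prod.swap_prod_mk]
      grind
    rw [Matrix.mul_apply]
    simp only [Matrix.map_apply, hR, map_add, mul_add, Finset.sum_add_distrib]
    simp [apply_ite (algebraMap ℂ A), mul_ite, h21, Algebra.smul_def, Algebra.commutes]
    congr 1
    rw [← map_sub, Algebra.commutes]
  unfold rttL rttR
  rw [mul_assoc]
  constructor
  · intro h i j k l
    rw [← hL, ← hRt, h]
  · intro h
    ext ⟨i, j⟩ ⟨k, l⟩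
    rw [hL, hRt, h]

/-- Sign of an arbitrary sequence of indices. -/
noncomputable def wt (a b : Fin n) : ℂ := if a < b then 1 else if b < a then -P.q b a else 0

noncomputable def wtSeq (k : Fin n → Fin n) : ℂ :=
  ∏ ij : Fin n × Fin n with ij.1 < ij.2, P.wt (k ij.1) (k ij.2)

theorem wtSeq_perm (σ : Equiv.Perm (Fin n)) : P.wtSeq σ = qSign P.q σ := by
  unfold wtSeq qSign
  rw [← Finset.filter_filter, Finset.prod_filter (p := fun ij : Fin n × Fin n => σ ij.2 < σ ij.1)]
  refine Finset.prod_congr rfl fun ij h => ?_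
  have h' : σ ij.1 ≠ σ ij.2 := fun e => by
    have := σ.injective e; simp at h; omega
  unfold wt
  grind

theorem wtSeq_swap (m : ℕ) (hm : m + 1 < n) (k : Fin n → Fin n) :
    P.wtSeq (k ∘ Equiv.swap (⟨m, by omega⟩ : Fin n) ⟨m + 1, hm⟩)
        * P.wt (k ⟨m, by omega⟩) (k ⟨m + 1, hm⟩)
      = P.wtSeq k * P.wt (k ⟨m + 1, hm⟩) (k ⟨m, by omega⟩) := by
  set a : Fin n := ⟨m, by omega⟩ with ha
  set b : Fin n := ⟨m + 1, hm⟩ with hb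
  set s := Equiv.swap a b
  have hab : (a, b) ∈ (Finset.univ.filter fun ij : Fin n × Fin n => ij.1 < ij.2) := by
    simp [ha, hb]
  unfold wtSeq
  rw [← Finset.mul_prod_erase _ _ hab, ← Finset.mul_prod_erase _ _ hab]
  have key : ∏ x ∈ (Finset.univ.filter fun ij : Fin n × Fin n => ij.1 < ij.2).erase (a, b),
      P.wt ((k ∘ s) x.1) ((k ∘ s) x.2) =
      ∏ x ∈ (Finset.univ.filter fun ij : Fin n × Fin n => ij.1 < ij.2).erase (a, b),
      P.wt (k x.1) (k x.2) := by
    refine Finset.prod_equiv (Equiv.prodCongr s s) ?_ (fun _ _ => rfl)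
    rintro ⟨i, j⟩
    simp only [Finset.mem_erase, Finset.mem_filter, Finset.mem_univ, true_and,
      Equiv.prodCongr_apply, Prod.map_apply, ne_eq, Prod.mk.injEq, s, Equiv.swap_apply_def]
    simp only [Fin.ext_iff, Fin.lt_def, ha, hb]
    split_ifs <;> simp_all <;> omega
  rw [key]
  simp [s]
  ring


theorem q_ne (i j : Fin n) : P.q i j ≠ 0 := left_ne_zero_of_mul_eq_one (P.q_mul_q i j)
theorem p_ne (i j : Fin n) : P.p i j ≠ 0 := left_ne_zero_of_mul_eq_one (P.p_mul_p i j)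

/-- Row determinant of the matrix with rows selected by `k`. -/
noncomputable def rowDet (T : Matrix (Fin n) (Fin n) A) (k : Fin n → Fin n) : A :=
  ∑ σ : Equiv.Perm (Fin n), qSign P.q σ • (List.ofFn fun i => T (k i) (σ i)).prod

/-- The two-row relation behind the exchange of adjacent rows. -/
theorem two_row (T : Matrix (Fin n) (Fin n) A) (hT : P.rttL T = P.rttR T) {a b c d : Fin n}
    (hba : b < a) (hcd : c < d) :
    T a c * T b d - P.q c d • (T a d * T b c)
      = (-P.q b a) • (T b c * T a d - P.q c d • (T b d * T a c)) := by
  rw [P.rtt_iff] at hT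
  have e1 := hT b a c d
  have e2 := hT b a d c
  have u0 := P.u_ne_zero
  have q1 := P.q_ne b a
  have q2 := P.q_ne c d
  have p1 : P.p b a = P.u ^ 2 / P.q b a := by rw [← P.p_mul_q _ _ hba]; field_simp
  have p2 : P.p c d = P.u ^ 2 / P.q c d := by rw [← P.p_mul_q _ _ hcd]; field_simp
  simp only [rDiag, hba.ne, hcd.ne, hcd.ne', if_false, hba.not_gt, hcd.not_gt, hcd, if_true,
    zero_smul, add_zero] at e1 e2
  have f2 : T a c * T b d = (P.q b a * P.q c d / P.u ^ 2) • (T b d * T a c) := by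
    have : T a c * T b d = (P.u * (P.p c d)⁻¹) • ((P.u⁻¹ * P.p c d) • (T a c * T b d)) := by
      rw [smul_smul, p2]
      field_simp
      simp
    rw [this, ← e2, smul_smul, p2]
    congr 1
    field_simp
  have f1 : T a d * T b c = (P.q b a / P.q c d) • (T b c * T a d)
      - ((P.u ^ 2 - 1) / P.q c d) • (T a c * T b d) := by
    have : T a d * T b c = (P.u * (P.q c d)⁻¹) • ((P.u⁻¹ * P.q c d) • (T a d * T b c)) := by
      rw [smul_smul]
      field_simp
      simp
    rw [this, eq_sub_of_add_eq e1.symm, smul_sub, smul_smul, smul_smul]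
    congr 2 <;> field_simp
  rw [f1, f2]
  match_scalars <;> field_simp <;> ring

theorem one_row (T : Matrix (Fin n) (Fin n) A) (hT : P.rttL T = P.rttR T) {a c d : Fin n}
    (hcd : c < d) : T a c * T a d = P.q c d • (T a d * T a c) := by
  rw [P.rtt_iff] at hT
  have e := hT a a c d
  have u0 := P.u_ne_zero
  simp only [rDiag, hcd.ne, if_false, hcd.not_gt, hcd, if_true, lt_irrefl, zero_smul, add_zero] at e
  have : T a c * T a d = P.u • (P.u • (T a c * T a d) - (P.u - P.u⁻¹) • (T a c * T a d)) := by
    match_scalars; field_simp; ring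
  rw [this, e]
  match_scalars
  field_simp
  ring

theorem sum_pair {C : Type*} [AddCommGroup C] {a b : Fin n} (hab : a ≠ b)
    (f : Equiv.Perm (Fin n) → C)
    (h : ∀ σ : Equiv.Perm (Fin n), σ a < σ b → f σ + f (σ * Equiv.swap a b) = 0) :
    ∑ σ, f σ = 0 := by
  refine Finset.sum_involution (fun σ _ => σ * Equiv.swap a b) ?_ ?_ (by simp) ?_
  · intro σ _
    rcases lt_or_gt_of_ne (fun e => hab (σ.injective e)) with hlt | hlt
    · exact h σ hlt
    · have := h (σ * Equiv.swap a b) (by simpa using hlt)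
      rw [add_comm]
      simpa [mul_assoc] using this
  · intro σ _ _ e
    have := congrArg (fun τ : Equiv.Perm (Fin n) => τ a) e
    simp at this
    exact hab this.symm
  · intro σ _
    simp [mul_assoc]

theorem qSign_swap (m : ℕ) (hm : m + 1 < n) (σ : Equiv.Perm (Fin n))
    (h : σ ⟨m, by omega⟩ < σ ⟨m + 1, hm⟩) :
    qSign P.q (σ * Equiv.swap (⟨m, by omega⟩ : Fin n) ⟨m + 1, hm⟩)
      = -P.q (σ ⟨m, by omega⟩) (σ ⟨m + 1, hm⟩) * qSign P.q σ := by
  have := P.wtSeq_swap m hm σ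
  simp only [wt, h, h.not_gt, if_true, if_false, mul_one] at this
  rw [← P.wtSeq_perm, ← P.wtSeq_perm, mul_comm, ← this]
  rfl

theorem rowDet_swap (T : Matrix (Fin n) (Fin n) A) (hT : P.rttL T = P.rttR T) (m : ℕ)
    (hm : m + 1 < n) (k : Fin n → Fin n) (hk : k ⟨m + 1, hm⟩ < k ⟨m, by omega⟩) :
    P.rowDet T k = (-P.q (k ⟨m + 1, hm⟩) (k ⟨m, by omega⟩)) •
      P.rowDet T (k ∘ Equiv.swap (⟨m, by omega⟩ : Fin n) ⟨m + 1, hm⟩) := by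
  rw [← sub_eq_zero]
  unfold rowDet
  rw [Finset.smul_sum, ← Finset.sum_sub_distrib]
  refine sum_pair (a := ⟨m, by omega⟩) (b := ⟨m + 1, hm⟩) (by simp) _ fun σ hσ => ?_
  rw [P.qSign_swap m hm σ hσ]
  have key := P.two_row T hT hk hσ
  set a : Fin n := ⟨m, by omega⟩ with ha
  set b : Fin n := ⟨m + 1, hm⟩ with hb
  set s := Equiv.swap a b with hs
  have hsl : ∀ i : Fin n, (i : ℕ) < m → s i = i := fun i hi =>
    Equiv.swap_apply_of_ne_of_ne (by simp [Fin.ext_iff, ha]; omega)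
      (by simp [Fin.ext_iff, hb]; omega)
  have hsr : ∀ i : Fin n, m + 2 ≤ (i : ℕ) → s i = i := fun i hi =>
    Equiv.swap_apply_of_ne_of_ne (by simp [Fin.ext_iff, ha]; omega)
      (by simp [Fin.ext_iff, hb]; omega)
  have hsa : s a = b := Equiv.swap_apply_left _ _
  have hsb : s b = a := Equiv.swap_apply_right _ _
  obtain ⟨L, hL⟩ : ∃ L, L = ((List.ofFn fun i => T (k i) (σ i)).take m).prod := ⟨_, rfl⟩
  obtain ⟨R, hR⟩ : ∃ R, R = ((List.ofFn fun i => T (k i) (σ i)).drop (m + 2)).prod := ⟨_, rfl⟩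
  have e1 : (List.ofFn fun i => T (k i) (σ i)).prod
      = L * (T (k a) (σ a) * T (k b) (σ b)) * R := by
    rw [prod_ofFn_split m hm, ← hL, ← hR]
  have e2 : (List.ofFn fun i => T ((k ∘ s) i) (σ i)).prod
      = L * (T (k b) (σ a) * T (k a) (σ b)) * R := by
    rw [prod_ofFn_split m hm, hL, hR,
      take_ofFn_congr m _ (fun i => T (k i) (σ i)) (fun i hi => by simp [hsl i hi]),
      drop_ofFn_congr (m + 2) _ (fun i => T (k i) (σ i)) (fun i hi => by simp [hsr i hi])]
    simp [← ha, ← hb, hsa, hsb]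
  have e3 : (List.ofFn fun i => T (k i) ((σ * s) i)).prod
      = L * (T (k a) (σ b) * T (k b) (σ a)) * R := by
    rw [prod_ofFn_split m hm, hL, hR,
      take_ofFn_congr m _ (fun i => T (k i) (σ i)) (fun i hi => by simp [hsl i hi]),
      drop_ofFn_congr (m + 2) _ (fun i => T (k i) (σ i)) (fun i hi => by simp [hsr i hi])]
    simp [← ha, ← hb, hsa, hsb]
  have e4 : (List.ofFn fun i => T ((k ∘ s) i) ((σ * s) i)).prod
      = L * (T (k b) (σ b) * T (k a) (σ a)) * R := by
    rw [prod_ofFn_split m hm, hL, hR,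
      take_ofFn_congr m _ (fun i => T (k i) (σ i)) (fun i hi => by simp [hsl i hi]),
      drop_ofFn_congr (m + 2) _ (fun i => T (k i) (σ i)) (fun i hi => by simp [hsr i hi])]
    simp [← ha, ← hb, hsa, hsb]
  rw [e1, e2, e3, e4]
  have key2 := congrArg (fun z => qSign P.q σ • (L * z * R)) key
  simp only [mul_sub, sub_mul, mul_smul_comm, smul_mul_assoc] at key2
  rw [← sub_eq_zero] at key2
  rw [← key2]
  module

theorem rowDet_eq_zero (T : Matrix (Fin n) (Fin n) A) (hT : P.rttL T = P.rttR T) (m : ℕ)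
    (hm : m + 1 < n) (k : Fin n → Fin n) (hk : k ⟨m + 1, hm⟩ = k ⟨m, by omega⟩) :
    P.rowDet T k = 0 := by
  unfold rowDet
  refine sum_pair (a := ⟨m, by omega⟩) (b := ⟨m + 1, hm⟩) (by simp) _ fun σ hσ => ?_
  rw [P.qSign_swap m hm σ hσ]
  have key := P.one_row T hT (a := k ⟨m, by omega⟩) hσ
  set a : Fin n := ⟨m, by omega⟩ with ha
  set b : Fin n := ⟨m + 1, hm⟩ with hb
  set s := Equiv.swap a b with hs
  have hsl : ∀ i : Fin n, (i : ℕ) < m → s i = i := fun i hi =>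
    Equiv.swap_apply_of_ne_of_ne (by simp [Fin.ext_iff, ha]; omega)
      (by simp [Fin.ext_iff, hb]; omega)
  have hsr : ∀ i : Fin n, m + 2 ≤ (i : ℕ) → s i = i := fun i hi =>
    Equiv.swap_apply_of_ne_of_ne (by simp [Fin.ext_iff, ha]; omega)
      (by simp [Fin.ext_iff, hb]; omega)
  have hsa : s a = b := Equiv.swap_apply_left _ _
  have hsb : s b = a := Equiv.swap_apply_right _ _
  have e3 : (List.ofFn fun i => T (k i) ((σ * s) i)).prod
      = ((List.ofFn fun i => T (k i) (σ i)).take m).prod *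
        (T (k a) (σ b) * T (k b) (σ a)) * ((List.ofFn fun i => T (k i) (σ i)).drop (m + 2)).prod := by
    rw [prod_ofFn_split m hm,
      take_ofFn_congr m _ (fun i => T (k i) (σ i)) (fun i hi => by simp [hsl i hi]),
      drop_ofFn_congr (m + 2) _ (fun i => T (k i) (σ i)) (fun i hi => by simp [hsr i hi])]
    simp [← ha, ← hb, hsa, hsb]
  rw [e3, prod_ofFn_split m hm, ← ha, ← hb, hk, key]
  simp only [mul_smul_comm, smul_mul_assoc]
  module

theorem rowDet_eq (T : Matrix (Fin n) (Fin n) A) (hT : P.rttL T = P.rttR T) :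
    ∀ k : Fin n → Fin n, P.rowDet T k = P.wtSeq k • rdet P.q T := by
  have main : ∀ N : ℕ, ∀ k : Fin n → Fin n, ∑ i : Fin n, (i : ℕ) * (n - k i) = N →
      P.rowDet T k = P.wtSeq k • rdet P.q T := by
    intro N
    induction N using Nat.strong_induction_on with
    | _ N ih =>
    intro k hN
    by_cases hmono : ∀ m (hm : m + 1 < n), k ⟨m, by omega⟩ < k ⟨m + 1, hm⟩
    · have hs : StrictMono k := by
        cases n with
        | zero => intro a; exact a.elim0
        | succ n =>
          refine Fin.strictMono_iff_lt_succ.2 fun i => ?_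
          exact hmono i (by omega)
      have hid : k = id := by
        have := Subsingleton.elim (hs.orderIsoOfSurjective k
          (Finite.surjective_of_injective hs.injective)) (OrderIso.refl (Fin n))
        funext i
        exact congrArg (fun e : Fin n ≃o Fin n => e i) this
      subst hid
      have h1 := P.wtSeq_perm 1
      have : qSign P.q (1 : Equiv.Perm (Fin n)) = 1 := by
        unfold qSign
        rw [Finset.filter_false_of_mem, Finset.prod_empty]
        rintro ⟨i, j⟩ -
        simp
        exact fun h => h.le
      rw [this] at h1
      have h1' : P.wtSeq id = 1 := h1
      rw [h1', one_smul]
      rfl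
    · push Not at hmono
      obtain ⟨m, hm, hle⟩ := hmono
      have hw := P.wtSeq_swap m hm k
      rcases hle.eq_or_lt with heq | hlt
      · rw [P.rowDet_eq_zero T hT m hm k heq]
        have : P.wtSeq k = 0 := by
          unfold wtSeq
          refine Finset.prod_eq_zero (i := (⟨m, by omega⟩, ⟨m + 1, hm⟩)) (by simp) ?_
          simp [wt, heq]
        rw [this, zero_smul]
      · rw [P.rowDet_swap T hT m hm k hlt]
        rw [ih _ _ _ rfl, smul_smul]
        · congr 1
          simp only [wt, hlt, hlt.not_gt, if_true, if_false] at hw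
          rw [mul_one] at hw
          rw [← hw, mul_comm]
        · rw [← hN]
          set a : Fin n := ⟨m, by omega⟩ with ha
          set b : Fin n := ⟨m + 1, hm⟩ with hb
          have hab : a ≠ b := by simp [ha, hb]
          rw [← Finset.add_sum_erase _ _ (Finset.mem_univ a),
            ← Finset.add_sum_erase _ (fun i : Fin n => (i : ℕ) * (n - k i)) (Finset.mem_univ a),
            ← Finset.add_sum_erase _ _ (Finset.mem_erase.2 ⟨hab.symm, Finset.mem_univ b⟩),
            ← Finset.add_sum_erase _ (fun i : Fin n => (i : ℕ) * (n - k i))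
              (Finset.mem_erase.2 ⟨hab.symm, Finset.mem_univ b⟩), ← add_assoc, ← add_assoc]
          refine add_lt_add_of_lt_of_le ?_ (le_of_eq ?_)
          · simp only [Function.comp_apply, Equiv.swap_apply_left, Equiv.swap_apply_right]
            have h1 : (k b : ℕ) < k a := hlt
            have h2 := (k a).isLt
            simp only [ha, hb] at h1 h2 ⊢
            obtain ⟨x, hx⟩ : ∃ x, n - (k ⟨m, by omega⟩ : ℕ) = x := ⟨_, rfl⟩
            obtain ⟨y, hy⟩ : ∃ y, n - (k ⟨m + 1, hm⟩ : ℕ) = y := ⟨_, rfl⟩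
            rw [hx, hy]
            have : x < y := by omega
            nlinarith
          · refine Finset.sum_congr rfl fun i hi => ?_
            simp only [Finset.mem_erase] at hi
            rw [Function.comp_apply, Equiv.swap_apply_of_ne_of_ne hi.2.1 hi.1]
  exact fun k => main _ k rfl

theorem rdet_mul (S T : Matrix (Fin n) (Fin n) A) (hT : P.rttL T = P.rttR T)
    (hc : ∀ i j k l, Commute (S i j) (T k l)) :
    rdet P.q (S * T) = rdet P.q S * rdet P.q T := by
  have h1 : rdet P.q (S * T) = ∑ k : Fin n → Fin n,
      (List.ofFn fun i => S i (k i)).prod * P.rowDet T k := by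
    unfold rdet rowDet
    simp only [Finset.mul_sum]
    rw [Finset.sum_comm]
    refine Finset.sum_congr rfl fun σ _ => ?_
    simp only [mul_smul_comm, ← Finset.smul_sum, Matrix.mul_apply]
    rw [prod_ofFn_sum fun i k => S i k * T k (σ i)]
    congr 1
    refine Finset.sum_congr rfl fun f _ => ?_
    exact prod_ofFn_mul _ _ fun i j => hc _ _ _ _
  rw [h1, rdet, Finset.sum_mul]
  simp only [P.rowDet_eq T hT]
  symm
  refine Finset.sum_of_injOn (fun σ : Equiv.Perm (Fin n) => (σ : Fin n → Fin n)) ?_ ?_ ?_ ?_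
  · exact fun _ _ _ _ h => DFunLike.coe_injective h
  · simp
  · intro k _ hk
    have : P.wtSeq k = 0 := by
      have hni : ¬ Function.Injective k := fun hi =>
        hk (Set.mem_image_of_mem _ (x := Equiv.ofBijective k (Finite.injective_iff_bijective.1 hi))
          (by simp))
      simp only [Function.Injective, not_forall] at hni
      obtain ⟨i, j, hij, hne⟩ := hni
      rcases lt_or_gt_of_ne hne with h | h
      · exact Finset.prod_eq_zero (i := (i, j)) (by simpa using h) (by simp [wt, hij])
      · exact Finset.prod_eq_zero (i := (j, i)) (by simpa using h) (by simp [wt, hij])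
    simp [this]
  · intro σ _
    rw [P.wtSeq_perm]
    simp


theorem rtt_mul (S T : Matrix (Fin n) (Fin n) A) (hS : P.rttL S = P.rttR S)
    (hT : P.rttL T = P.rttR T) (hc : ∀ i j k l, Commute (S i j) (T k l)) :
    P.rttL (S * T) = P.rttR (S * T) := by
  have e1 : (S * T) ⊗ₖ (1 : Matrix (Fin n) (Fin n) A) = (S ⊗ₖ 1) * (T ⊗ₖ 1) := by
    ext ⟨i, j⟩ ⟨k, l⟩
    simp [Matrix.mul_apply, Fintype.sum_prod_type, Matrix.kroneckerMap_apply, Matrix.one_apply]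
  have e2 : (1 : Matrix (Fin n) (Fin n) A) ⊗ₖ (S * T) = (1 ⊗ₖ S) * (1 ⊗ₖ T) := by
    ext ⟨i, j⟩ ⟨k, l⟩
    simp [Matrix.mul_apply, Fintype.sum_prod_type, Matrix.kroneckerMap_apply, Matrix.one_apply]
  have c1 : (T ⊗ₖ (1 : Matrix (Fin n) (Fin n) A)) * (1 ⊗ₖ S) = (1 ⊗ₖ S) * (T ⊗ₖ 1) := by
    ext ⟨i, j⟩ ⟨k, l⟩
    simp [Matrix.mul_apply, Fintype.sum_prod_type, Matrix.kroneckerMap_apply, Matrix.one_apply]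
    exact (hc _ _ _ _).symm.eq
  have c2 : ((1 : Matrix (Fin n) (Fin n) A) ⊗ₖ T) * (S ⊗ₖ 1) = (S ⊗ₖ 1) * (1 ⊗ₖ T) := by
    ext ⟨i, j⟩ ⟨k, l⟩
    simp [Matrix.mul_apply, Fintype.sum_prod_type, Matrix.kroneckerMap_apply, Matrix.one_apply]
    exact (hc _ _ _ _).symm.eq
  unfold rttL rttR at *
  rw [e1, e2]
  calc _ = (P.R.map (algebraMap ℂ A) * (S ⊗ₖ 1) * ((T ⊗ₖ 1) * (1 ⊗ₖ S))) * (1 ⊗ₖ T) := by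
        simp only [mul_assoc]
    _ = (P.R.map (algebraMap ℂ A) * (S ⊗ₖ 1) * (1 ⊗ₖ S)) * ((T ⊗ₖ 1) * (1 ⊗ₖ T)) := by
        rw [c1]; simp only [mul_assoc]
    _ = (1 ⊗ₖ S) * (S ⊗ₖ 1) * (P.R.map (algebraMap ℂ A) * (T ⊗ₖ 1) * (1 ⊗ₖ T)) := by
        rw [hS]; simp only [mul_assoc]
    _ = (1 ⊗ₖ S) * ((S ⊗ₖ 1) * (1 ⊗ₖ T)) * (T ⊗ₖ 1) * P.R.map (algebraMap ℂ A) := by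
        rw [hT]; simp only [mul_assoc]
    _ = _ := by rw [← c2]; simp only [mul_assoc]

/-- The matrix over `M_n(ℂ)` whose `(i, j)` entry is the block `(X_{(k,i),(l,j)})_{k,l}`. -/
def block (X : Matrix (Fin n × Fin n) (Fin n × Fin n) ℂ) :
    Matrix (Fin n) (Fin n) (Matrix (Fin n) (Fin n) ℂ) :=
  fun i j k l => X (k, i) (l, j)

theorem rDiag_ne (i j : Fin n) : P.rDiag i j ≠ 0 := by
  unfold rDiag
  have := P.u_ne_zero
  have := P.p_ne j i
  have := P.q_ne i j
  split_ifs <;> simp [*]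

theorem rDiag_mul (i j : Fin n) (h : i ≠ j) : P.rDiag i j * P.rDiag j i = 1 := by
  have u0 := P.u_ne_zero
  unfold rDiag
  rcases lt_or_gt_of_ne h with h | h
  · simp only [h.ne, h.ne', h.not_gt, h, if_true, if_false]
    have := P.p_mul_q i j h
    field_simp
    linear_combination this
  · simp only [h.ne, h.ne', h.not_gt, h, if_true, if_false]
    have := P.p_mul_q j i h
    field_simp
    linear_combination this

theorem rDiag_self (i : Fin n) : P.rDiag i i = P.u := by simp [rDiag]

theorem Rminus_apply (a b : Fin n × Fin n) : P.Rminus a b =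
    if a = b then (P.rDiag a.1 a.2)⁻¹
    else if a = b.swap ∧ a.2 < a.1 then P.u⁻¹ - P.u else 0 := by
  have : P.Rminus = Matrix.of fun a b : Fin n × Fin n => if a = b then (P.rDiag a.1 a.2)⁻¹
    else if a = b.swap ∧ a.2 < a.1 then P.u⁻¹ - P.u else 0 := by
    unfold Rminus
    apply Matrix.inv_eq_right_inv
    ext ⟨i, j⟩ ⟨k, l⟩
    have hR : ∀ b : Fin n × Fin n, P.R (i, j) b = (if b = (i, j) then P.rDiag i j else 0)
        + (if b = (j, i) then (if j < i then P.u - P.u⁻¹ else 0) else 0) := by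
      rintro ⟨a, b⟩
      simp only [R, Prod.mk.injEq, Prod.swap_prod_mk]
      grind
    rw [Matrix.mul_apply]
    simp only [hR, Matrix.of_apply, add_mul, ite_mul, zero_mul, Finset.sum_add_distrib, Finset.sum_ite_eq',
      Finset.mem_univ, if_true, Matrix.one_apply, Prod.mk.injEq, Prod.swap_prod_mk]
    have h1 := P.rDiag_ne i j
    have h2 := P.rDiag_ne j i
    have h3 := P.rDiag_mul i j
    by_cases hji : j < i
    · have h4 := h3 hji.ne'
      have h5 : P.rDiag i j = (P.rDiag j i)⁻¹ := eq_inv_of_mul_eq_one_left h4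
      have := hji.ne
      have := hji.ne'
      have := hji.not_gt
      simp only [hji, if_true, this]
      rw [h5]
      by_cases e1 : i = k ∧ j = l
      · obtain ⟨rfl, rfl⟩ := e1
        simp [*]
      · by_cases e2 : i = l ∧ j = k
        · obtain ⟨rfl, rfl⟩ := e2
          simp [*]
          ring
        · have e2' : ¬ (j = k ∧ i = l) := fun h => e2 ⟨h.2, h.1⟩
          have e1' : ¬ (j = l ∧ i = k) := fun h => e1 ⟨h.2, h.1⟩
          simp [e1, e2, e1', e2']
    · simp [hji]
      by_cases e1 : i = k ∧ j = l
      · simp [e1]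
        rw [← e1.1, ← e1.2, mul_inv_cancel₀ h1]
      · simp [e1]
  rw [this]
  rfl

theorem block_rtt_aux (D E e : Fin n → Fin n → ℂ)
    (he : ∀ i j, e i j = if j < i then P.u - P.u⁻¹ else 0)
    (gen : ∀ a i j, i ≠ j → a ≠ j → a ≠ i →
      P.rDiag i j * D a i * E a j = P.rDiag i a * E a j * D j i ∧
      P.rDiag i j * E a i * D i j + e i j * E a j * E j i
        = P.rDiag a j * D a j * E a i + e j a * E a j * E j i ∧
      P.rDiag i j * E a i * E i j + e i j * E a j * D j i = e i a * E a j * D j i ∧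
      e i j * D a j * E a i = P.rDiag j a * E a j * E j i + e a j * D a j * E a i)
    (hi : ∀ a i, P.rDiag i i * D a i * E a i
        = P.rDiag i a * E a i * D i i + e a i * D a i * E a i ∧
      P.rDiag i i * E a i * D i i = P.rDiag a i * D a i * E a i + e i a * E a i * D i i)
    (hE : ∀ i j, E i j * E j i = 0)
    (hj : ∀ i j, i ≠ j → P.rDiag i j * E j i * D i j + e i j * D j j * E j i
        = P.rDiag j j * D j j * E j i)
    (ha : ∀ i j, i ≠ j → P.rDiag i j * D i i * E i j + e i j * E i j * D j i
        = P.rDiag i i * E i j * D j i)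
    (X : Matrix (Fin n × Fin n) (Fin n × Fin n) ℂ)
    (hX : ∀ a i b j, X (a, i) (b, j) = (if a = b then (if i = j then D a i else 0) else 0)
      + (if i = b then (if a = j then E a i else 0) else 0)) :
    P.rttL (block X) = P.rttR (block X) := by
  have e0 : ∀ i, e i i = 0 := fun i => by simp [he]
  rw [P.rtt_iff]
  intro i j k l
  ext a b
  obtain ⟨δ, hδ⟩ : ∃ δ : Fin n → Fin n → Fin n → ℂ, δ = fun x y z =>
    if k = x then (if l = y then (if b = z then 1 else 0) else 0) else 0 := ⟨_, rfl⟩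
  have hp : ∀ i j, (block X i k * block X j l) a b =
      D a i * D a j * δ i j a + D a i * E a j * δ i a j + E a i * D i j * δ a j i
        + E a i * E i j * δ a i j := by
    intro i j
    simp only [Matrix.mul_apply, block, hX, add_mul, ite_mul, zero_mul, Finset.sum_add_distrib,
      Finset.sum_ite_eq, Finset.mem_univ, if_true]
    simp only [hδ, mul_ite, mul_one, mul_zero, mul_add, eq_comm (b := k), eq_comm (b := l),
      eq_comm (b := b)]
    clear gen hi hj ha hX hE e0 he
    split_ifs <;> ring
  have hq : ∀ i j, (block X j l * block X i k) a b =
      D a j * D a i * δ i j a + D a j * E a i * δ a j i + E a j * D j i * δ i a j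
        + E a j * E j i * δ j a i := by
    intro i j
    simp only [Matrix.mul_apply, block, hX, add_mul, ite_mul, zero_mul, Finset.sum_add_distrib,
      Finset.sum_ite_eq, Finset.mem_univ, if_true]
    simp only [hδ, mul_ite, mul_one, mul_zero, mul_add, eq_comm (b := k), eq_comm (b := l),
      eq_comm (b := b)]
    clear gen hi hj ha hX hE e0 he
    split_ifs <;> ring
  have hd : ∀ x y z, P.rDiag k l * δ x y z = P.rDiag x y * δ x y z := by
    intro x y z
    simp only [hδ]
    split_ifs with h1 h2 h3 <;> simp [*]
  have hg : ∀ x y z, e l k * δ x y z = e y x * δ x y z := by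
    intro x y z
    simp only [hδ]
    split_ifs with h1 h2 h3 <;> simp [*]
  simp only [Matrix.add_apply, Matrix.smul_apply, hp, hq, smul_eq_mul, ← he]
  have r1 := hd i j a
  have r2 := hd a j i
  have r3 := hd i a j
  have r4 := hd j a i
  have s1 := hg j i a
  have s2 := hg j a i
  have s3 := hg a i j
  have s4 := hg a j i
  by_cases hij : i = j
  · subst hij
    have := e0 i
    obtain ⟨g1, g2⟩ := hi a i
    have hEi : E i i = 0 := mul_self_eq_zero.1 (hE i i)
    simp only [hEi, e0, mul_zero, zero_mul, add_zero] at *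
    linear_combination δ i a i * g1 + δ a i i * g2 - D a i * D a i * r1 - D a i * E a i * r2
      - E a i * D i i * r3 - D a i * D a i * s1 - D a i * E a i * s2 - E a i * D i i * s3
  · by_cases haj : a = j
    · subst haj
      have hEa : E a a = 0 := mul_self_eq_zero.1 (hE a a)
      have hEia := hE i a
      have hja := hj i a hij
      simp only [hEa, e0, mul_zero, zero_mul, add_zero] at *
      linear_combination δ a a i * hja + P.rDiag i a * δ a i a * hEia - D a a * D a i * r1 - D a a * E a i * r2
        - D a a * D a i * s1 - D a a * E a i * s2
    · by_cases hai : a = i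
      · subst hai
        have hEa : E a a = 0 := mul_self_eq_zero.1 (hE a a)
        have hEaj := hE a j
        have haa := ha a j hij
        simp only [hEa, e0, mul_zero, zero_mul, add_zero] at *
        linear_combination δ a a j * haa + (e a j - e j a) * δ a j a * hEaj
          - P.rDiag j a * δ j a a * hEaj - D a j * D a a * r1
          - E a j * D j a * r3 - E a j * E j a * r4
          - D a j * D a a * s1 - E a j * D j a * s3 - E a j * E j a * s4
      · obtain ⟨g1, g2, g3, g4⟩ := gen a i j hij haj hai
        linear_combination δ i a j * g1 + δ a j i * g2 + δ a i j * g3 + δ j a i * g4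
          - D a j * D a i * r1 - D a j * E a i * r2 - E a j * D j i * r3 - E a j * E j i * r4
          - D a j * D a i * s1 - D a j * E a i * s2 - E a j * D j i * s3 - E a j * E j i * s4

theorem block_plus_rtt : P.rttL (block P.Rplus) = P.rttR (block P.Rplus) := by
  have u0 := P.u_ne_zero
  refine P.block_rtt_aux (fun a i => P.rDiag i a) (fun a i => if a < i then P.u - P.u⁻¹ else 0)
    (fun i j => if j < i then P.u - P.u⁻¹ else 0) (fun _ _ => rfl) ?_ ?_ ?_ ?_ ?_ _ ?_
  · intro a i j hij haj _
    have h1 := P.rDiag_mul i j hij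
    have h2 := P.rDiag_mul a j haj
    refine ⟨by ring, ?_, ?_, ?_⟩
    · split_ifs <;> first | omega | linear_combination (P.u - P.u⁻¹) * (h1 - h2) | ring
    all_goals split_ifs <;> first | omega | ring
  · intro a i
    simp only [P.rDiag_self]
    rcases lt_trichotomy a i with h | h | h
    · have h1 := P.rDiag_mul a i h.ne
      simp only [h, h.not_gt, if_true, if_false]
      constructor
      · ring
      · rw [h1]; field_simp; ring
    · simp [h]
    · simp [h.not_gt]
  · intro i j
    split_ifs <;> first | omega | ring
  · intro i j hij
    simp only [P.rDiag_self]
    have h1 := P.rDiag_mul i j hij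
    split_ifs
    · rw [mul_right_comm, h1]; field_simp; ring
    · ring
  · intro i j hij
    simp only [P.rDiag_self]
    split_ifs <;> first | omega | ring
  · intro a i b j
    simp only [Rplus, Matrix.submatrix_apply, Prod.swap_prod_mk, R, Prod.mk.injEq]
    grind

theorem block_minus_rtt : P.rttL (block P.Rminus) = P.rttR (block P.Rminus) := by
  have u0 := P.u_ne_zero
  have dinv : ∀ i j, i ≠ j → (P.rDiag i j)⁻¹ = P.rDiag j i := fun i j h =>
    inv_eq_of_mul_eq_one_right (P.rDiag_mul i j h)
  refine P.block_rtt_aux (fun a i => (P.rDiag a i)⁻¹)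
    (fun a i => if i < a then P.u⁻¹ - P.u else 0)
    (fun i j => if j < i then P.u - P.u⁻¹ else 0) (fun _ _ => rfl) ?_ ?_ ?_ ?_ ?_ _ ?_
  · intro a i j hij haj hai
    have h1 := P.rDiag_mul i j hij
    have h2 := P.rDiag_mul a j haj
    simp only [dinv _ _ hij, dinv _ _ hij.symm, dinv _ _ haj, dinv _ _ hai]
    refine ⟨by ring, ?_, ?_, ?_⟩
    · split_ifs <;> first | omega | linear_combination (P.u⁻¹ - P.u) * (h1 - h2) | ring
    all_goals split_ifs <;> first | omega | ring
  · intro a i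
    simp only [P.rDiag_self]
    rcases lt_trichotomy a i with h | h | h
    · simp [h.not_gt]
    · simp [h]
    · simp only [h, h.not_gt, if_true, if_false, dinv _ _ h.ne']
      have h1 := P.rDiag_mul a i h.ne'
      constructor
      · field_simp; ring
      · rw [h1]; field_simp; ring
  · intro i j
    split_ifs <;> first | omega | ring
  · intro i j hij
    simp only [P.rDiag_self, dinv _ _ hij]
    have h1 := P.rDiag_mul i j hij
    split_ifs
    · omega
    · rw [mul_right_comm, h1]; field_simp; ring
    · ring
    · ring
  · intro i j hij
    simp only [P.rDiag_self, dinv _ _ hij.symm]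
    split_ifs
    · field_simp; ring
    · ring
  · intro a i b j
    simp only [Rminus_apply, Prod.swap_prod_mk, Prod.mk.injEq]
    grind


theorem list_prod_tri (r : Fin n → Fin n → Prop) (h1 : ∀ a b c, r a b → r a c ∨ r c b)
    (h2 : ∀ a c, c ≠ a → r a c ∨ r c a) (h3 : ∀ a, ¬ r a a) :
    ∀ L : List (Matrix (Fin n) (Fin n) ℂ), (∀ M ∈ L, ∀ a b, r a b → M a b = 0) →
      (∀ a b, r a b → L.prod a b = 0) ∧ ∀ a, L.prod a a = (L.map fun M => M a a).prod
  | [], _ => by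
    refine ⟨fun a b h => ?_, fun a => by simp⟩
    have : a ≠ b := fun e => h3 b (e ▸ h)
    simp [this]
  | M :: L, h => by
    obtain ⟨ih1, ih2⟩ := list_prod_tri r h1 h2 h3 L fun M hM => h M (List.mem_cons_of_mem _ hM)
    have hM := h M List.mem_cons_self
    refine ⟨fun a b hab => ?_, fun a => ?_⟩
    · rw [List.prod_cons, Matrix.mul_apply]
      refine Finset.sum_eq_zero fun c _ => ?_
      rcases h1 a b c hab with hh | hh
      · rw [hM _ _ hh, zero_mul]
      · rw [ih1 _ _ hh, mul_zero]
    · rw [List.prod_cons, Matrix.mul_apply, List.map_cons, List.prod_cons, ← ih2]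
      refine Finset.sum_eq_single a (fun c _ hc => ?_) (by simp)
      rcases h2 a c hc with hh | hh
      · rw [hM _ _ hh, zero_mul]
      · rw [ih1 _ _ hh, mul_zero]

theorem qSign_one (q : Fin n → Fin n → ℂ) : qSign q 1 = 1 := by
  unfold qSign
  rw [Finset.filter_false_of_mem, Finset.prod_empty]
  rintro ⟨i, j⟩ -
  simp
  exact fun h => h.le

theorem rdet_tri (r : Fin n → Fin n → Prop) (h1 : ∀ a b c, r a b → r a c ∨ r c b)
    (h2 : ∀ a c, c ≠ a → r a c ∨ r c a) (h3 : ∀ a, ¬ r a a) (q : Fin n → Fin n → ℂ)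
    (T : Matrix (Fin n) (Fin n) (Matrix (Fin n) (Fin n) ℂ))
    (hT : ∀ i j a b, r a b → T i j a b = 0) (hd : ∀ i j a, i ≠ j → T i j a a = 0) :
    (∀ a b, r a b → rdet q T a b = 0) ∧ ∀ a, rdet q T a a = ∏ i, T i i a a := by
  have key := fun σ : Equiv.Perm (Fin n) => list_prod_tri r h1 h2 h3
    (List.ofFn fun i => T i (σ i)) (fun M hM => by
      obtain ⟨i, rfl⟩ := (List.mem_ofFn' _ _).1 hM
      exact hT _ _)
  refine ⟨fun a b hab => ?_, fun a => ?_⟩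
  · rw [rdet, Matrix.sum_apply]
    exact Finset.sum_eq_zero fun σ _ => by
      rw [Matrix.smul_apply, (key σ).1 a b hab, smul_zero]
  · rw [rdet, Matrix.sum_apply, Finset.sum_eq_single 1]
    · rw [Matrix.smul_apply, (key 1).2, qSign_one, one_smul, List.map_ofFn, List.prod_ofFn]
      rfl
    · intro σ _ hσ
      obtain ⟨i, hi⟩ : ∃ i, σ i ≠ i := by
        by_contra! hc
        exact hσ (Equiv.ext hc)
      rw [Matrix.smul_apply, (key σ).2, List.map_ofFn, List.prod_ofFn,
        Finset.prod_eq_zero (Finset.mem_univ i), smul_zero]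
      exact hd _ _ _ hi.symm
    · simp

theorem isUnit_rdet_plus : IsUnit (rdet P.q (block P.Rplus)) := by
  obtain ⟨t1, t2⟩ := rdet_tri (fun a b : Fin n => b < a) (fun a b c h => by omega)
    (fun a c h => by omega) (fun a => lt_irrefl a) P.q (block P.Rplus)
    (fun i j a b h => by
      simp only [block, Rplus, R, Matrix.submatrix_apply, Prod.swap_prod_mk, Prod.mk.injEq]
      grind)
    (fun i j a h => by
      simp only [block, Rplus, R, Matrix.submatrix_apply, Prod.swap_prod_mk, Prod.mk.injEq]
      grind)
  rw [Matrix.isUnit_iff_isUnit_det, Matrix.det_of_isUpperTriangular (fun a b h => t1 a b h),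
    isUnit_iff_ne_zero]
  refine Finset.prod_ne_zero_iff.2 fun a _ => ?_
  rw [t2]
  refine Finset.prod_ne_zero_iff.2 fun i _ => ?_
  simpa [block, Rplus, R] using P.rDiag_ne i a

theorem isUnit_rdet_minus : IsUnit (rdet P.q (block P.Rminus)) := by
  obtain ⟨t1, t2⟩ := rdet_tri (fun a b : Fin n => a < b) (fun a b c h => by omega)
    (fun a c h => by omega) (fun a => lt_irrefl a) P.q (block P.Rminus)
    (fun i j a b h => by
      simp only [block, Rminus_apply, Prod.swap_prod_mk, Prod.mk.injEq]
      grind)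
    (fun i j a h => by
      simp only [block, Rminus_apply, Prod.swap_prod_mk, Prod.mk.injEq]
      grind)
  rw [Matrix.isUnit_iff_isUnit_det, Matrix.det_of_isLowerTriangular _ (fun a b h => t1 a b h),
    isUnit_iff_ne_zero]
  refine Finset.prod_ne_zero_iff.2 fun a _ => ?_
  rw [t2]
  refine Finset.prod_ne_zero_iff.2 fun i _ => ?_
  simpa [block, Rminus_apply] using P.rDiag_ne a i

variable {B : Type*} [Ring B] [Algebra ℂ B]

theorem map_rdet (f : A →ₐ[ℂ] B) (q : Fin n → Fin n → ℂ) (T : Matrix (Fin n) (Fin n) A) :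
    f (rdet q T) = rdet q (T.map f) := by
  simp only [rdet, map_sum, map_smul, map_list_prod, List.map_ofFn]
  rfl

theorem map_rttL (f : A →ₐ[ℂ] B) (T : Matrix (Fin n) (Fin n) A) :
    (P.rttL T).map f = P.rttL (T.map f) := by
  unfold rttL
  rw [Matrix.map_mul, Matrix.map_mul, Matrix.map_map]
  congr 1
  · congr 1
    · ext a b; simp
    · ext a b; simp [Matrix.one_apply, apply_ite f]
  · ext a b; simp [Matrix.one_apply, apply_ite f]

theorem map_rttR (f : A →ₐ[ℂ] B) (T : Matrix (Fin n) (Fin n) A) :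
    (P.rttR T).map f = P.rttR (T.map f) := by
  unfold rttR
  rw [Matrix.map_mul, Matrix.map_mul, Matrix.map_map]
  congr 1
  · congr 1
    · ext a b; simp [Matrix.one_apply, apply_ite f]
    · ext a b; simp [Matrix.one_apply, apply_ite f]
  · ext a b; simp

/-! ### The quantum group -/

/-- Free algebra on the `t_ij` and one more generator, the inverse of the determinant. -/
abbrev Free (n : ℕ) : Type := FreeAlgebra ℂ (Option (Fin n × Fin n))

/-- The generic matrix of the free algebra. -/
noncomputable def freeT (n : ℕ) : Matrix (Fin n) (Fin n) (Free n) :=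
  fun i j => FreeAlgebra.ι ℂ (some (i, j))

/-- The defining relations: `R T₁ T₂ = T₂ T₁ R`, and the extra generator is a two-sided inverse
of `det_q(T)`. -/
inductive Rel : Free n → Free n → Prop
  | rtt (a b : Fin n × Fin n) : Rel (P.rttL (freeT n) a b) (P.rttR (freeT n) a b)
  | inv_mul : Rel (FreeAlgebra.ι ℂ none * rdet P.q (freeT n)) 1
  | mul_inv : Rel (rdet P.q (freeT n) * FreeAlgebra.ι ℂ none) 1

/-- The coordinate algebra `GL_{p,u}(n) = M_{p,u}(n)[det_q⁻¹]`: the algebra generated by the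
`t_ij` subject to `R T₁ T₂ = T₂ T₁ R`, with `det_q(T)` inverted. -/
def QGL : Type := RingQuot P.Rel

noncomputable instance : Ring P.QGL := inferInstanceAs (Ring (RingQuot P.Rel))
noncomputable instance : Algebra ℂ P.QGL := inferInstanceAs (Algebra ℂ (RingQuot P.Rel))

/-- The quotient map. -/
noncomputable def quot : Free n →ₐ[ℂ] P.QGL := RingQuot.mkAlgHom ℂ P.Rel

/-- The generating matrix `T = (t_ij)`. -/
noncomputable def T : Matrix (Fin n) (Fin n) P.QGL := (freeT n).map P.quot

theorem T_rtt : P.rttL P.T = P.rttR P.T := by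
  rw [T, ← map_rttL, ← map_rttR]
  ext a b
  exact RingQuot.mkAlgHom_rel ℂ (Rel.rtt a b)

/-- `det_q(T)` as a unit of the quantum group. -/
noncomputable def detUnit : P.QGLˣ where
  val := rdet P.q P.T
  inv := P.quot (FreeAlgebra.ι ℂ none)
  val_inv := by
    have := RingQuot.mkAlgHom_rel ℂ (Rel.mul_inv (P := P))
    rw [map_mul, map_one] at this
    rw [T, ← map_rdet]
    exact this
  inv_val := by
    have := RingQuot.mkAlgHom_rel ℂ (Rel.inv_mul (P := P))
    rw [map_mul, map_one] at this
    rw [T, ← map_rdet]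
    exact this

/-- Universal property of the quantum group. -/
noncomputable def lift (S : Matrix (Fin n) (Fin n) A) (hS : P.rttL S = P.rttR S)
    (hu : IsUnit (rdet P.q S)) : P.QGL →ₐ[ℂ] A :=
  RingQuot.liftAlgHom ℂ ⟨FreeAlgebra.lift ℂ fun
    | some ij => S ij.1 ij.2
    | none => ((hu.unit⁻¹ : Aˣ) : A), by
      have hm : ∀ f : Free n →ₐ[ℂ] A, (∀ i j, f (FreeAlgebra.ι ℂ (some (i, j))) = S i j) →
          (freeT n).map f = S := fun f hf => by ext i j; exact hf i j
      intro x y h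
      induction h with
      | rtt a b =>
        have e1 := congrFun (congrFun (P.map_rttL (FreeAlgebra.lift ℂ fun
          | some ij => S ij.1 ij.2
          | none => ((hu.unit⁻¹ : Aˣ) : A)) (freeT n)) a) b
        have e2 := congrFun (congrFun (P.map_rttR (FreeAlgebra.lift ℂ fun
          | some ij => S ij.1 ij.2
          | none => ((hu.unit⁻¹ : Aˣ) : A)) (freeT n)) a) b
        rw [hm _ (by simp)] at e1 e2
        exact e1.trans ((congrFun (congrFun hS a) b).trans e2.symm)
      | inv_mul =>
        rw [map_mul, map_rdet, hm _ (by simp)]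
        simp
      | mul_inv =>
        rw [map_mul, map_rdet, hm _ (by simp)]
        simp⟩

/-- The matrix with entries `∑_k t_ik ⊗ t_kj`. -/
noncomputable def comulMatrix : Matrix (Fin n) (Fin n) (P.QGL ⊗[ℂ] P.QGL) :=
  fun i j => ∑ k, P.T i k ⊗ₜ[ℂ] P.T k j

theorem comulMatrix_spec : P.rttL P.comulMatrix = P.rttR P.comulMatrix ∧
    IsUnit (rdet P.q P.comulMatrix) := by
  let f : P.QGL →ₐ[ℂ] P.QGL ⊗[ℂ] P.QGL := Algebra.TensorProduct.includeLeft
  let g : P.QGL →ₐ[ℂ] P.QGL ⊗[ℂ] P.QGL := Algebra.TensorProduct.includeRight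
  have hc : ∀ i j k l, Commute (P.T.map f i j) (P.T.map g k l) := fun i j k l => by
    simp [f, g, Commute, SemiconjBy]
  have e : P.comulMatrix = P.T.map f * P.T.map g := by
    ext i j
    simp [comulMatrix, Matrix.mul_apply, f, g]
  have hf : P.rttL (P.T.map f) = P.rttR (P.T.map f) := by
    rw [← map_rttL, ← map_rttR, T_rtt]
  have hg : P.rttL (P.T.map g) = P.rttR (P.T.map g) := by
    rw [← map_rttL, ← map_rttR, T_rtt]
  rw [e]
  refine ⟨P.rtt_mul _ _ hf hg hc, ?_⟩
  rw [P.rdet_mul _ _ hg hc, ← map_rdet, ← map_rdet]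
  exact (P.detUnit.isUnit.map f).mul (P.detUnit.isUnit.map g)

/-! ### Comultiplication, pairing and actions -/

/-- The comultiplication `Δ(t_ij) = ∑_k t_ik ⊗ t_kj`. -/
noncomputable def comul : P.QGL →ₐ[ℂ] P.QGL ⊗[ℂ] P.QGL :=
  P.lift P.comulMatrix P.comulMatrix_spec.1 P.comulMatrix_spec.2

/-- The algebra homomorphism `φ ↦ ((l⁺_ij, φ))_{i,j}`. It is determined by `(L⁺₁, T₂) = R⁺`, that is
`(l⁺_kl, t_ij) = R⁺_{(k,i),(l,j)}`; multiplicativity is the rule `(a, φψ) = (Δ(a), φ ⊗ ψ)` with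
`Δ(l_ij) = ∑_k l_ik ⊗ l_kj`. -/
noncomputable def pairPlus : P.QGL →ₐ[ℂ] Matrix (Fin n) (Fin n) ℂ :=
  P.lift (block P.Rplus) P.block_plus_rtt P.isUnit_rdet_plus

/-- The same for `L⁻`, with `(L⁻₁, T₂) = R⁻`. -/
noncomputable def pairMinus : P.QGL →ₐ[ℂ] Matrix (Fin n) (Fin n) ℂ :=
  P.lift (block P.Rminus) P.block_minus_rtt P.isUnit_rdet_minus

/-- The generator `l⁺_ij` as a linear functional. -/
noncomputable def lPlus (i j : Fin n) : P.QGL →ₗ[ℂ] ℂ :=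
  Matrix.entryLinearMap ℂ ℂ i j ∘ₗ P.pairPlus.toLinearMap

/-- The generator `l⁻_ij` as a linear functional. -/
noncomputable def lMinus (i j : Fin n) : P.QGL →ₗ[ℂ] ℂ :=
  Matrix.entryLinearMap ℂ ℂ i j ∘ₗ P.pairMinus.toLinearMap

/-- The left action `a.φ = (id ⊗ a)(Δ(φ))` of a functional `a`. -/
noncomputable def act (a : P.QGL →ₗ[ℂ] ℂ) : Module.End ℂ P.QGL :=
  (TensorProduct.rid ℂ P.QGL).toLinearMap ∘ₗ a.lTensor P.QGL ∘ₗ P.comul.toLinearMap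

/-- `L(x) = x L⁺ - x⁻¹ L⁻`, as a matrix of operators (left action). -/
noncomputable def Lop (x : ℂ) : Matrix (Fin n) (Fin n) (Module.End ℂ P.QGL) :=
  fun i j => x • P.act (P.lPlus i j) - x⁻¹ • P.act (P.lMinus i j)

/-- `S(T)`: the antipode applied to the generating matrix, i.e. the two-sided inverse of `T` in
the ring of matrices over the quantum group. -/
noncomputable def antipodeT : Matrix (Fin n) (Fin n) P.QGL := Ring.inverse P.T

/-- The matrix `∂(x)` of quantum differential operators, given by
`(u - u⁻¹) ∂(x)ᵗ φ = (L(x).φ) S(T)`. -/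
noncomputable def del (x : ℂ) : Matrix (Fin n) (Fin n) (Module.End ℂ P.QGL) := fun i j =>
  (P.u - P.u⁻¹)⁻¹ • ∑ k, LinearMap.mulRight ℂ (P.antipodeT k i) ∘ₗ P.Lop x j k

/-! ### The scalars -/

/-- `α_k = u^{2-n} ∏_{j<k} q_jk ∏_{j>k} p_kj`. -/
noncomputable def α (k : Fin n) : ℂ :=
  P.u ^ (2 - (n : ℤ)) * (∏ j with j < k, P.q j k) * ∏ j with k < j, P.p k j

/-- `β_k = u^{n-2} ∏_{j<k} p_jk⁻¹ ∏_{j>k} q_kj⁻¹`. -/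
noncomputable def β (k : Fin n) : ℂ :=
  P.u ^ ((n : ℤ) - 2) * (∏ j with j < k, (P.p j k)⁻¹) * ∏ j with k < j, (P.q k j)⁻¹

/-- `γ_{k,s}(x) = x α_k^s - x⁻¹ β_k^s`. -/
noncomputable def γ (k : Fin n) (s : ℕ) (x : ℂ) : ℂ := x * P.α k ^ s - x⁻¹ * P.β k ^ s

end MultiParam

/-! Write the row determinant as a sum over words g₁⋯gₙ of f(g) ∂_{1g₁}⋯∂_{ngₙ}, with f alternating
for the parameters p⁻¹, and apply the operators to det^s one at a time, the last one first. Two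
facts make each application explicit.

The functionals l^±_ij are the entries of a matrix representation of the coordinate algebra, so L^±
acts through an algebra homomorphism into matrices (`coaction`). It sends det^s to a diagonal matrix
with entries α_k^s det^s, respectively β_k^s det^s, and it twists the entries of S(T) by (R^±)⁻¹
(`coaction_antipodeT`). Moreover, the alternating weight is an eigenvector of (R^±)⁻¹ composed with
the flip, with eigenvalue -u for L⁺ and -u⁻¹ for L⁻ (`wt_mul_Rplus_inv`, `wt_mul_R`). Hence pushing
L^± past t entries of S(T) inside an alternating sum costs only (-u)^t or (-u⁻¹)^t
(`sum_apply_iterSum`).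

Since β_k = u⁻² α_k (`β_eq`), the L⁺ and L⁻ parts are proportional, and the induction `iterSum_del`
closes: after t operators there is det^s times an alternating sum of t entries of S(T) in reversed
order, and the next operator contributes the scalar (u - u⁻¹)⁻¹ (x(-u)^t - x⁻¹ u^{-2s} (-u⁻¹)^t).
After n operators the alternating sum is a multiple of det⁻¹ (`iterSum_antipodeT`), because T S(T) =
1 telescopes. Reversing the word produces ∏ (-p_ij⁻¹), whose sign cancels that of the powers of -u;
the scalars together with ∏ α_k^s form the γ's.

This rests on the equality of the row and column determinants (`cdet_eq_rdet`) and on the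
invertibility of T (`isUnit_of_isUnit_rdet`). -/

namespace MultiParam

variable {n : ℕ} (P : MultiParam n) {A : Type*} [Ring A] [Algebra ℂ A]

/-! ### Exchanging the two families of parameters -/

/-- The parameters with `p` and `q` exchanged. -/
def flip : MultiParam n where
  u := P.u
  p := P.q
  q := P.p
  u_ne_zero := P.u_ne_zero
  u_sq_ne := P.u_sq_ne
  p_mul_q i j h := by rw [mul_comm]; exact P.p_mul_q i j h
  p_mul_p := P.q_mul_q
  q_mul_q := P.p_mul_p
  p_self := P.q_self
  q_self := P.p_self

theorem rDiag_flip (i j : Fin n) : P.flip.rDiag i j = P.rDiag j i := by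
  rcases lt_trichotomy i j with h | h | h
  · simp [rDiag, flip, h.ne, h.ne', h, h.not_gt]
  · simp [rDiag, flip, h]
  · simp [rDiag, flip, h.ne, h.ne', h, h.not_gt]

/-- Reading the (l, k, j, i) component of the relation backwards gives the (i, j, k, l) component
for the transpose. Every statement about rows thereby yields one about columns, with p in place of
q. -/
theorem rtt_transpose {T : Matrix (Fin n) (Fin n) A} (hT : P.rttL T = P.rttR T) :
    P.flip.rttL T.transpose = P.flip.rttR T.transpose := by
  rw [rtt_iff] at hT ⊢
  intro i j k l
  simp only [rDiag_flip, Matrix.transpose_apply]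
  exact (hT l k j i).symm

/-- Entries in antidiagonal position commute up to a scalar. -/
theorem antidiagonal_comm {T : Matrix (Fin n) (Fin n) A} (hT : P.rttL T = P.rttR T)
    {a b c d : Fin n} (hba : b < a) (hcd : c < d) :
    P.q c d • (T b d * T a c) = P.p b a • (T a c * T b d) := by
  rw [P.rtt_iff] at hT
  have e2 := hT b a d c
  have u0 := P.u_ne_zero
  simp only [rDiag, hba.ne, hcd.ne', if_false, hba.not_gt, hcd.not_gt, hcd, if_true,
    zero_smul, add_zero] at e2
  have q1 := P.q_ne b a
  have q2 := P.q_ne c d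
  have p1 : P.p b a = P.u ^ 2 / P.q b a := by rw [← P.p_mul_q _ _ hba]; field_simp
  have p2 : P.p c d = P.u ^ 2 / P.q c d := by rw [← P.p_mul_q _ _ hcd]; field_simp
  -- This scalar normalises the left coefficient to q_cd; the right one becomes p_cd q_cd / q_ba =
  -- u² / q_ba = p_ba.
  have e3 := congrArg (fun z => (P.u * P.q c d / P.q b a) • z) e2
  simp only [smul_smul] at e3
  convert e3 using 2
  · field_simp
  · rw [p1, p2]; field_simp

/-! ### Sorting monomials: row determinant versus column determinant -/

/-- Induction along adjacent descents of a permutation. -/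
theorem perm_descent_induction {motive : Equiv.Perm (Fin n) → Prop} (one : motive 1)
    (step : ∀ (ρ : Equiv.Perm (Fin n)) (m : ℕ) (hm : m + 1 < n),
      ρ ⟨m + 1, hm⟩ < ρ ⟨m, by omega⟩ →
      motive (ρ * Equiv.swap (⟨m, by omega⟩ : Fin n) ⟨m + 1, hm⟩) → motive ρ)
    (ρ : Equiv.Perm (Fin n)) : motive ρ := by
  -- The weighted sum strictly decreases when an adjacent descent is undone: the larger value moves
  -- to the right, where its small complement n - k i gets the larger weight. A permutation without
  -- descents is increasing, hence the identity.
  have main : ∀ N : ℕ, ∀ k : Equiv.Perm (Fin n), ∑ i : Fin n, (i : ℕ) * (n - k i) = N →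
      motive k := by
    intro N
    induction N using Nat.strong_induction_on with
    | _ N ih =>
    intro k hN
    by_cases hmono : ∀ m (hm : m + 1 < n), k ⟨m, by omega⟩ < k ⟨m + 1, hm⟩
    · have hs : StrictMono k := by
        cases n with
        | zero => intro a; exact a.elim0
        | succ n => exact Fin.strictMono_iff_lt_succ.2 fun i => hmono i (by omega)
      have hid : k = 1 := by
        have := Subsingleton.elim (hs.orderIsoOfSurjective k k.surjective)
          (OrderIso.refl (Fin n))
        ext i
        exact congrArg (fun e : Fin n ≃o Fin n => (e i : ℕ)) this
      rwa [hid]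
    · push Not at hmono
      obtain ⟨m, hm, hle⟩ := hmono
      have hlt := lt_of_le_of_ne hle (fun e => by simpa using k.injective e)
      refine step k m hm hlt (ih _ ?_ _ rfl)
      rw [← hN]
      set a : Fin n := ⟨m, by omega⟩ with ha
      set b : Fin n := ⟨m + 1, hm⟩ with hb
      have hab : a ≠ b := by simp [ha, hb]
      rw [← Finset.add_sum_erase _ _ (Finset.mem_univ a),
        ← Finset.add_sum_erase _ (fun i : Fin n => (i : ℕ) * (n - k i)) (Finset.mem_univ a),
        ← Finset.add_sum_erase _ _ (Finset.mem_erase.2 ⟨hab.symm, Finset.mem_univ b⟩),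
        ← Finset.add_sum_erase _ (fun i : Fin n => (i : ℕ) * (n - k i))
          (Finset.mem_erase.2 ⟨hab.symm, Finset.mem_univ b⟩), ← add_assoc, ← add_assoc]
      refine add_lt_add_of_lt_of_le ?_ (le_of_eq ?_)
      · simp only [Equiv.Perm.coe_mul, Function.comp_apply, Equiv.swap_apply_left,
          Equiv.swap_apply_right]
        have h1 : (k b : ℕ) < k a := hlt
        have h2 := (k a).isLt
        have h3 : (b : ℕ) = a + 1 := rfl
        rw [h3]
        obtain ⟨x, hx⟩ : ∃ x, n - (k a : ℕ) = x := ⟨_, rfl⟩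
        obtain ⟨y, hy⟩ : ∃ y, n - (k b : ℕ) = y := ⟨_, rfl⟩
        rw [hx, hy]
        have : x < y := by omega
        nlinarith
      · refine Finset.sum_congr rfl fun i hi => ?_
        simp only [Finset.mem_erase] at hi
        rw [Equiv.Perm.coe_mul, Function.comp_apply, Equiv.swap_apply_of_ne_of_ne hi.2.1 hi.1]
  exact main _ ρ rfl

theorem qSign_ne_zero (σ : Equiv.Perm (Fin n)) : qSign P.q σ ≠ 0 :=
  Finset.prod_ne_zero_iff.2 fun _ _ => neg_ne_zero.2 (P.q_ne _ _)

/-- A monomial whose column inversions are not row inversions can be sorted by columns. -/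
theorem sort_columns {T : Matrix (Fin n) (Fin n) A} (hT : P.rttL T = P.rttR T)
    (ρ : Equiv.Perm (Fin n)) : ∀ τ : Equiv.Perm (Fin n),
    (∀ i j, i < j → ρ j < ρ i → τ i < τ j) →
    (qSign P.q ρ * qSign P.p τ) • (List.ofFn fun i => T (τ i) (ρ i)).prod
      = qSign P.p (τ * ρ⁻¹) • (List.ofFn fun i => T ((τ * ρ⁻¹) i) i).prod := by
  induction ρ using perm_descent_induction with
  | one => intro τ _; simp [qSign_one]
  | step ρ m hm hlt ih =>
    intro τ hτ
    set a : Fin n := ⟨m, by omega⟩ with ha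
    set b : Fin n := ⟨m + 1, hm⟩ with hb
    set s := Equiv.swap a b with hs
    have hab : a < b := by simp [ha, hb]
    have hsa : s a = b := Equiv.swap_apply_left _ _
    have hsb : s b = a := Equiv.swap_apply_right _ _
    have hs' : ∀ i : Fin n, i ≠ a → i ≠ b → s i = i := fun i h1 h2 =>
      Equiv.swap_apply_of_ne_of_ne h1 h2
    have hτab := hτ a b hab hlt
    -- The swap `s` reverses the order of no pair except (a, b), and that pair is not an inversion
    -- of ρs, so the hypothesis on inversions passes to (τs, ρs). The quotient τρ⁻¹ is unchanged.
    have e := ih (τ * s) (fun i j hij h => by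
      simp only [Equiv.Perm.coe_mul, Function.comp_apply] at h ⊢
      by_cases hsij : s i < s j
      · exact hτ _ _ hsij h
      · exfalso
        have : i = a ∧ j = b := by
          simp only [hs, Equiv.swap_apply_def] at hsij
          simp only [Fin.ext_iff, Fin.lt_def, ha, hb] at *
          split_ifs at hsij <;> simp_all <;> omega
        rw [this.1, this.2, hsa, hsb] at h
        exact absurd h hlt.not_gt)
    have hss : τ * s * (ρ * s)⁻¹ = τ * ρ⁻¹ := by
      rw [mul_inv_rev, hs, Equiv.swap_inv]
      simp [mul_assoc]
    rw [hss] at e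
    rw [← e]
    have w1 := P.qSign_swap m hm (ρ * s) (by simpa [← ha, ← hb, hsa, hsb] using hlt)
    have w2 := P.flip.qSign_swap m hm τ hτab
    rw [← ha, ← hb, ← hs] at w1 w2
    have hρ : ρ * s * s = ρ := by simp [hs, mul_assoc]
    rw [hρ] at w1
    change qSign P.p (τ * s) = -P.p (τ a) (τ b) * qSign P.p τ at w2
    rw [w1, w2]
    simp only [Equiv.Perm.coe_mul, Function.comp_apply, hsa, hsb]
    -- At the descent of ρ the rows ascend, so the two neighbouring factors are in antidiagonal
    -- position and may be exchanged. The scalar matches the change in the two signs.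
    have key := P.antidiagonal_comm hT hτab hlt
    have t : ∀ i : Fin n, (i : ℕ) < m → s i = i := fun i hi =>
      hs' i (by simp [Fin.ext_iff, ha]; omega) (by simp [Fin.ext_iff, hb]; omega)
    have d : ∀ i : Fin n, m + 2 ≤ (i : ℕ) → s i = i := fun i hi =>
      hs' i (by simp [Fin.ext_iff, ha]; omega) (by simp [Fin.ext_iff, hb]; omega)
    rw [prod_ofFn_split m hm, prod_ofFn_split m hm (fun i => T (τ (s i)) (ρ (s i))),
      take_ofFn_congr m (fun i => T (τ (s i)) (ρ (s i))) (fun i => T (τ i) (ρ i))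
        (fun i hi => by simp [t i hi]),
      drop_ofFn_congr (m + 2) (fun i => T (τ (s i)) (ρ (s i))) (fun i => T (τ i) (ρ i))
        (fun i hi => by simp [d i hi])]
    simp only [← ha, ← hb, hsa, hsb]
    obtain ⟨L, hL⟩ : ∃ L, L = ((List.ofFn fun i => T (τ i) (ρ i)).take m).prod := ⟨_, rfl⟩
    obtain ⟨R, hR⟩ : ∃ R, R = ((List.ofFn fun i => T (τ i) (ρ i)).drop (m + 2)).prod := ⟨_, rfl⟩
    rw [← hL, ← hR]
    have key2 := congrArg (fun z => (-(qSign P.q (ρ * s) * qSign P.p τ)) • (L * z * R)) key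
    simp only [mul_smul_comm, smul_mul_assoc, smul_smul] at key2
    convert key2 using 2 <;> ring

/-- The row and column determinants of an `RTT` matrix agree. -/
theorem cdet_eq_rdet {T : Matrix (Fin n) (Fin n) A} (hT : P.rttL T = P.rttR T) :
    cdet P.p T = rdet P.q T := by
  unfold cdet rdet
  -- The determinants agree term by term: the row monomial of σ is the column monomial of σ⁻¹.
  rw [← Equiv.sum_comp (Equiv.inv (Equiv.Perm (Fin n)))]
  refine Finset.sum_congr rfl fun σ _ => ?_
  have := P.sort_columns hT σ 1 (fun i j hij _ => hij)
  rw [qSign_one, mul_one, one_mul] at this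
  exact this.symm

/-! ### Invertibility of the generating matrix -/

theorem wtSeq_eq_zero {k : Fin n → Fin n} (hk : ¬ Function.Injective k) : P.wtSeq k = 0 := by
  simp only [Function.Injective, not_forall] at hk
  obtain ⟨i, j, hij, hne⟩ := hk
  rcases lt_or_gt_of_ne hne with h | h
  · exact Finset.prod_eq_zero (i := (i, j)) (by simpa using h) (by simp [wt, hij])
  · exact Finset.prod_eq_zero (i := (j, i)) (by simpa using h) (by simp [wt, hij])

theorem wtSeq_ne_zero {k : Fin n → Fin n} (hk : Function.Injective k) : P.wtSeq k ≠ 0 := by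
  have := P.wtSeq_perm (Equiv.ofBijective k (Finite.injective_iff_bijective.1 hk))
  rw [Equiv.coe_ofBijective] at this
  rw [this]
  exact P.qSign_ne_zero _

/-- Row expansion: a right inverse. -/
theorem exists_mul_eq_one {T : Matrix (Fin n) (Fin n) A} (hT : P.rttL T = P.rttR T)
    (hu : IsUnit (rdet P.q T)) : ∃ N : Matrix (Fin n) (Fin n) A, T * N = 1 := by
  obtain ⟨v, hv⟩ := hu.exists_right_inv
  cases n with
  | zero => exact ⟨1, Subsingleton.elim _ _⟩
  | succ n =>
    -- Unnormalised cofactors. Prepending row i' gives the determinant with row sequence i' followed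
    -- by all rows except i: it vanishes for i' ≠ i by repetition, and otherwise is a nonzero
    -- multiple of the determinant.
    let N : Matrix (Fin (n + 1)) (Fin (n + 1)) A := fun j i =>
      ∑ σ : Equiv.Perm (Fin (n + 1)), if σ 0 = j then qSign P.q σ •
        (List.ofFn fun m : Fin n => T (i.succAbove m) (σ m.succ)).prod else 0
    have hN : ∀ i' i, ∑ j, T i' j * N j i
        = P.wtSeq (Fin.cons i' i.succAbove) • rdet P.q T := by
      intro i' i
      rw [← P.rowDet_eq T hT, rowDet]
      simp only [N, Finset.mul_sum]
      rw [Finset.sum_comm]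
      refine Finset.sum_congr rfl fun σ _ => ?_
      simp [List.ofFn_succ, mul_ite]
    refine ⟨Matrix.of fun j i => (P.wtSeq (Fin.cons i i.succAbove))⁻¹ • (N j i * v), ?_⟩
    ext i' i
    simp only [Matrix.mul_apply, Matrix.of_apply, mul_smul_comm, ← mul_assoc,
      ← Finset.smul_sum, ← Finset.sum_mul]
    rw [hN, smul_mul_assoc, hv, smul_smul, Matrix.one_apply]
    split_ifs with h
    · subst h
      rw [inv_mul_cancel₀, one_smul]
      refine P.wtSeq_ne_zero ?_
      rw [Fin.cons_injective_iff]
      exact ⟨by simp, Fin.succAbove_right_injective⟩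
    · rw [P.wtSeq_eq_zero (k := Fin.cons i' i.succAbove), mul_zero, zero_smul]
      rw [Fin.cons_injective_iff]
      rintro ⟨h1, -⟩
      rw [Fin.range_succAbove] at h1
      simp [h] at h1

/-- Row expansion along the last factor. -/
theorem exists_mul_transpose_eq_one {T : Matrix (Fin n) (Fin n) A} (hT : P.rttL T = P.rttR T)
    (hu : IsUnit (rdet P.q T)) : ∃ N : Matrix (Fin n) (Fin n) A, N * T.transpose = 1 := by
  obtain ⟨v, hv⟩ := hu.exists_left_inv
  cases n with
  | zero => exact ⟨1, Subsingleton.elim _ _⟩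
  | succ n =>
    -- With the expanded entry on the right, the sum runs over the second index of both factors, so
    -- the transpose appears.
    let N : Matrix (Fin (n + 1)) (Fin (n + 1)) A := fun i j =>
      ∑ σ : Equiv.Perm (Fin (n + 1)), if σ (Fin.last n) = j then qSign P.q σ •
        (List.ofFn fun m : Fin n => T (i.succAbove m) (σ m.castSucc)).prod else 0
    have hN : ∀ i' i, ∑ j, N i j * T i' j
        = P.wtSeq (Fin.snoc (α := fun _ => Fin (n + 1)) i.succAbove i') • rdet P.q T := by
      intro i' i
      rw [← P.rowDet_eq T hT, rowDet]
      simp only [N, Finset.sum_mul]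
      rw [Finset.sum_comm]
      refine Finset.sum_congr rfl fun σ _ => ?_
      conv_rhs => rw [List.ofFn_succ']
      simp [List.concat_eq_append]
    refine ⟨Matrix.of fun i j =>
      (P.wtSeq (Fin.snoc (α := fun _ => Fin (n + 1)) i.succAbove i))⁻¹ • (v * N i j), ?_⟩
    ext i i'
    simp only [Matrix.mul_apply, Matrix.of_apply, smul_mul_assoc, mul_assoc,
      ← Finset.smul_sum, ← Finset.mul_sum, Matrix.transpose_apply]
    rw [hN, mul_smul_comm, hv, smul_smul, Matrix.one_apply]
    split_ifs with h
    · subst h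
      rw [inv_mul_cancel₀, one_smul]
      refine P.wtSeq_ne_zero ?_
      rw [Fin.snoc_injective_iff]
      exact ⟨Fin.succAbove_right_injective, by simp⟩
    · rw [P.wtSeq_eq_zero (k := Fin.snoc (α := fun _ => Fin (n + 1)) i.succAbove i'),
        mul_zero, zero_smul]
      rw [Fin.snoc_injective_iff]
      rintro ⟨-, h1⟩
      rw [Fin.range_succAbove] at h1
      simp [Ne.symm h] at h1

/-- Over a noncommutative ring both one-sided inverses are needed. Row expansion gives the right
one. Expanding the transpose, whose row determinant for the flipped parameters is the column
determinant of T, gives the left one. -/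
theorem isUnit_of_isUnit_rdet {T : Matrix (Fin n) (Fin n) A} (hT : P.rttL T = P.rttR T)
    (hu : IsUnit (rdet P.q T)) : IsUnit T := by
  obtain ⟨N, hN⟩ := P.exists_mul_eq_one hT hu
  obtain ⟨M, hM⟩ := P.flip.exists_mul_transpose_eq_one (P.rtt_transpose hT)
    (by change IsUnit (cdet P.p T); rwa [P.cdet_eq_rdet hT])
  rw [Matrix.transpose_transpose] at hM
  exact isUnit_iff_exists_and_exists.2 ⟨⟨N, hN⟩, ⟨M, hM⟩⟩

/-- This ensures that `antipodeT` is a genuine inverse and not the default value 0 of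
`Ring.inverse`. -/
theorem isUnit_T : IsUnit P.T := P.isUnit_of_isUnit_rdet P.T_rtt P.detUnit.isUnit

theorem T_mul_antipodeT : P.T * P.antipodeT = 1 := Ring.mul_inverse_cancel _ P.isUnit_T

theorem antipodeT_mul_T : P.antipodeT * P.T = 1 := Ring.inverse_mul_cancel _ P.isUnit_T

/-! ### The action of a representation of the coordinate algebra -/

theorem lift_T (S : Matrix (Fin n) (Fin n) A) (hS : P.rttL S = P.rttR S)
    (hu : IsUnit (rdet P.q S)) (i j : Fin n) : P.lift S hS hu (P.T i j) = S i j := by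
  refine (RingQuot.liftAlgHom_mkAlgHom_apply ℂ _ _ _).trans ?_
  simp [freeT]

theorem comul_T (i j : Fin n) : P.comul (P.T i j) = ∑ k, P.T i k ⊗ₜ[ℂ] P.T k j :=
  P.lift_T _ _ _ i j

/-- Δ(T) is the product of T ⊗ 1 and 1 ⊗ T, whose entries commute, and the row determinant is
multiplicative on such products. -/
theorem comul_det : P.comul (rdet P.q P.T) = rdet P.q P.T ⊗ₜ[ℂ] rdet P.q P.T := by
  let f : P.QGL →ₐ[ℂ] P.QGL ⊗[ℂ] P.QGL := Algebra.TensorProduct.includeLeft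
  let g : P.QGL →ₐ[ℂ] P.QGL ⊗[ℂ] P.QGL := Algebra.TensorProduct.includeRight
  have hc : ∀ i j k l, Commute (P.T.map f i j) (P.T.map g k l) := fun i j k l => by
    simp [f, g, Commute, SemiconjBy]
  have hg : P.rttL (P.T.map g) = P.rttR (P.T.map g) := by
    rw [← map_rttL, ← map_rttR, T_rtt]
  have e : P.T.map P.comul = P.T.map f * P.T.map g := by
    ext i j
    simp [comul_T, Matrix.mul_apply, f, g]
  rw [map_rdet, e, P.rdet_mul _ _ hg hc, ← map_rdet, ← map_rdet]
  simp [f, g]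

/-- For a matrix representation `f`, the algebra homomorphism whose `(i, j)` entry is
`φ ↦ (id ⊗ f_ij)(Δ φ)`. -/
noncomputable def coaction (f : P.QGL →ₐ[ℂ] Matrix (Fin n) (Fin n) ℂ) :
    P.QGL →ₐ[ℂ] Matrix (Fin n) (Fin n) P.QGL :=
  (matrixEquivTensor (Fin n) ℂ P.QGL).symm.toAlgHom.comp
    ((Algebra.TensorProduct.map (AlgHom.id ℂ P.QGL) f).comp P.comul)

theorem coaction_of_comul (f : P.QGL →ₐ[ℂ] Matrix (Fin n) (Fin n) ℂ) {φ : P.QGL}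
    {ι : Type*} (s : Finset ι) (a b : ι → P.QGL) (h : P.comul φ = ∑ m ∈ s, a m ⊗ₜ[ℂ] b m)
    (i j : Fin n) : P.coaction f φ i j = ∑ m ∈ s, f (b m) i j • a m := by
  simp only [coaction, AlgHom.comp_apply, h, map_sum, Algebra.TensorProduct.map_tmul,
    Matrix.sum_apply]
  refine Finset.sum_congr rfl fun m _ => ?_
  simp [matrixEquivTensor_apply_symm, Algebra.smul_def, Algebra.commutes]

/-- Packaging the operators as entries of one algebra homomorphism turns their twisted Leibniz rule
into matrix multiplication. -/
theorem coaction_eq_act (f : P.QGL →ₐ[ℂ] Matrix (Fin n) (Fin n) ℂ) (φ : P.QGL) (i j : Fin n) :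
    P.coaction f φ i j = P.act (Matrix.entryLinearMap ℂ ℂ i j ∘ₗ f.toLinearMap) φ := by
  obtain ⟨s, h⟩ := TensorProduct.exists_finset (P.comul φ)
  rw [P.coaction_of_comul f s Prod.fst Prod.snd h]
  simp [act, h]

theorem coaction_T (f : P.QGL →ₐ[ℂ] Matrix (Fin n) (Fin n) ℂ) (i j k l : Fin n) :
    P.coaction f (P.T i j) k l = ∑ m, f (P.T m j) k l • P.T i m :=
  P.coaction_of_comul f Finset.univ _ _ (P.comul_T i j) k l

theorem coaction_det (f : P.QGL →ₐ[ℂ] Matrix (Fin n) (Fin n) ℂ) (k l : Fin n) :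
    P.coaction f (rdet P.q P.T) k l = f (rdet P.q P.T) k l • rdet P.q P.T := by
  rw [P.coaction_of_comul f {()} (fun _ => rdet P.q P.T) (fun _ => rdet P.q P.T)
    (by simp [comul_det])]
  simp

theorem coaction_det_pow (f : P.QGL →ₐ[ℂ] Matrix (Fin n) (Fin n) ℂ) (d : Fin n → ℂ)
    (hf : f (rdet P.q P.T) = Matrix.diagonal d) (s : ℕ) :
    P.coaction f (rdet P.q P.T ^ s) = Matrix.diagonal fun i => d i ^ s • rdet P.q P.T ^ s := by
  have : P.coaction f (rdet P.q P.T) = Matrix.diagonal fun i => d i • rdet P.q P.T := by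
    ext k l
    rw [coaction_det, hf]
    by_cases h : k = l
    · subst h; simp
    · simp [h]
  rw [map_pow, this, Matrix.diagonal_pow]
  congr 1
  ext i
  simp [smul_pow]

/-- Uniqueness of inverses: the image of S(T) is a left inverse of the image of T, while X Y = 1
makes the explicit matrix on the right-hand side a right inverse. -/
theorem coaction_antipodeT (f : P.QGL →ₐ[ℂ] Matrix (Fin n) (Fin n) ℂ)
    (X Y : Matrix (Fin n × Fin n) (Fin n × Fin n) ℂ) (hXY : X * Y = 1)
    (hf : ∀ i j, f (P.T i j) = block X i j) (a b k l : Fin n) :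
    P.coaction f (P.antipodeT a b) k l = ∑ c, Y (k, a) (l, c) • P.antipodeT c b := by
  let N : Matrix (Fin n) (Fin n) (Matrix (Fin n) (Fin n) P.QGL) := fun a b k l =>
    ∑ c, Y (k, a) (l, c) • P.antipodeT c b
  have h1 : P.antipodeT.map (P.coaction f) * P.T.map (P.coaction f) = 1 := by
    rw [← Matrix.map_mul, antipodeT_mul_T]
    simp [Matrix.map_one]
  have h2 : P.T.map (P.coaction f) * N = 1 := by
    ext i j k l
    have e : ∀ m c, ∑ b, ∑ r, X (k, m) (r, b) * Y (r, b) (l, c)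
        = if k = l ∧ m = c then 1 else 0 := by
      intro m c
      have := congrFun (congrFun hXY (k, m)) (l, c)
      rw [Matrix.mul_apply, Fintype.sum_prod_type, Finset.sum_comm, Matrix.one_apply] at this
      rw [this]
      simp
    calc _ = ∑ b, ∑ r, ∑ m, ∑ c, (X (k, m) (r, b) * Y (r, b) (l, c)) •
          (P.T i m * P.antipodeT c j) := by
          rw [Matrix.mul_apply, Matrix.sum_apply]
          refine Finset.sum_congr rfl fun b _ => ?_
          rw [Matrix.mul_apply]
          refine Finset.sum_congr rfl fun r _ => ?_
          rw [Matrix.map_apply, coaction_T, Finset.sum_mul_sum]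
          simp only [hf, block, smul_mul_smul_comm]
      _ = ∑ m, ∑ c, (∑ b, ∑ r, X (k, m) (r, b) * Y (r, b) (l, c)) •
          (P.T i m * P.antipodeT c j) := by
          simp only [Finset.sum_smul]
          have : ∀ F : Fin n → Fin n → Fin n → Fin n → P.QGL,
              ∑ b, ∑ r, ∑ m, ∑ c, F b r m c = ∑ m, ∑ c, ∑ b, ∑ r, F b r m c := by
            intro F
            have := Finset.sum_comm (s := Finset.univ) (t := Finset.univ)
              (f := fun x y : Fin n × Fin n => F x.1 x.2 y.1 y.2)
            simpa only [Fintype.sum_prod_type] using this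
          exact this fun b r m c => _
      _ = (P.T * P.antipodeT) i j * if k = l then 1 else 0 := by
          simp only [e, Matrix.mul_apply, ite_smul, one_smul, zero_smul]
          by_cases hkl : k = l <;> simp [hkl]
      _ = _ := by
          rw [T_mul_antipodeT]
          by_cases hij : i = j
          · subst hij; simp [Matrix.one_apply]
          · simp [hij]
  have h3 := left_inv_eq_right_inv h1 h2
  exact congrFun (congrFun (congrFun (congrFun h3 a) b) k) l

/-! ### The value of the determinant in a representation -/

/-- Weight conservation: X only keeps or swaps its two indices, so each block commutes with a
diagonal matrix D up to z_j / z_i. Along a permutation these ratios cancel, so the determinant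
commutes with D. -/
theorem rdet_block_off_diagonal (q : Fin n → Fin n → ℂ)
    (X : Matrix (Fin n × Fin n) (Fin n × Fin n) ℂ)
    (hX : ∀ a b, a ≠ b → a ≠ b.swap → X a b = 0) {a b : Fin n} (hab : a ≠ b) :
    rdet q (block X) a b = 0 := by
  -- Any nonzero, pairwise distinct values would do.
  let z : Fin n → ℂ := fun i => i + 1
  let D : Matrix (Fin n) (Fin n) ℂ := Matrix.diagonal z
  have hz : ∀ i, z i ≠ 0 := fun i => Nat.cast_add_one_ne_zero _
  have h1 : ∀ i j, z i • (D * block X i j) = z j • (block X i j * D) := by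
    intro i j
    ext k l
    simp only [D, Matrix.smul_apply, Matrix.diagonal_mul, Matrix.mul_diagonal, block, smul_eq_mul]
    by_cases e1 : (k, i) = (l, j)
    · obtain ⟨rfl, rfl⟩ := Prod.mk.inj e1; ring
    · by_cases e2 : (k, i) = Prod.swap (l, j)
      · obtain ⟨rfl, rfl⟩ := Prod.mk.inj e2; ring
      · rw [hX _ _ e1 e2]; ring
  have h2 : ∀ {m : ℕ} (c d : Fin m → Fin n),
      (∏ i, z (c i)) • (D * (List.ofFn fun i => block X (c i) (d i)).prod)
        = (∏ i, z (d i)) • ((List.ofFn fun i => block X (c i) (d i)).prod * D) := by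
    intro m
    induction m with
    | zero => intro c d; simp
    | succ m ih =>
      intro c d
      have := ih (fun i => c i.succ) (fun i => d i.succ)
      rw [List.ofFn_succ, List.prod_cons, Fin.prod_univ_succ, Fin.prod_univ_succ, mul_comm (z (c 0)),
        mul_smul, ← mul_assoc, ← smul_mul_assoc, h1, smul_mul_assoc, mul_assoc, smul_comm,
        ← mul_smul_comm, this, mul_smul_comm, mul_smul, mul_assoc]
  have h3 : D * rdet q (block X) = rdet q (block X) * D := by
    rw [rdet, Finset.mul_sum, Finset.sum_mul]
    refine Finset.sum_congr rfl fun σ _ => ?_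
    have := h2 (fun i : Fin n => i) σ
    rw [Equiv.prod_comp σ z] at this
    rw [mul_smul_comm, smul_mul_assoc,
      smul_right_injective _ (Finset.prod_ne_zero_iff.2 fun i _ => hz i) this]
  have h4 := congrFun (congrFun h3 a) b
  rw [Matrix.diagonal_mul, Matrix.mul_diagonal, mul_comm, ← sub_eq_zero, ← mul_sub] at h4
  refine (mul_eq_zero.1 h4).resolve_right ?_
  simpa [z, sub_eq_zero, Fin.ext_iff] using hab

theorem R_eq_zero (a b : Fin n × Fin n) (h1 : a ≠ b) (h2 : a ≠ b.swap) : P.R a b = 0 := by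
  simp [R, h1, h2]

/-! ### The scalars α and β as values of the determinant -/

theorem prod_lt_mul_prod_gt (c : ℂ) (k : Fin n) :
    (∏ j : Fin n with j < k, c) * (∏ j : Fin n with k < j, c) = c ^ (n - 1) := by
  rw [Finset.prod_const, Finset.prod_const, ← pow_add, Finset.filter_lt_eq_Ioi,
    Finset.filter_gt_eq_Iio, Fin.card_Ioi, Fin.card_Iio]
  congr 1
  omega

theorem prod_rDiag (k : Fin n) : ∏ i, P.rDiag i k = P.α k := by
  have u0 := P.u_ne_zero
  have h : ∀ i, P.rDiag i k = (if i = k then P.u else 1) *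
      ((if i < k then P.u⁻¹ * P.q i k else 1) * (if k < i then P.u⁻¹ * P.p k i else 1)) := by
    intro i
    rcases lt_trichotomy i k with h | h | h
    · simp [rDiag, h.ne, h.not_gt, h]
    · simp [rDiag, h]
    · simp [rDiag, h.ne', h.not_gt, h]
  simp only [h, Finset.prod_mul_distrib, Finset.prod_ite_eq', Finset.mem_univ, if_true,
    ← Finset.prod_filter]
  have := prod_lt_mul_prod_gt P.u⁻¹ k
  have hn : P.u * P.u⁻¹ ^ (n - 1) = P.u ^ (2 - (n : ℤ)) := by
    have : 0 < n := k.pos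
    rw [show (2 - (n : ℤ)) = 1 - ((n - 1 : ℕ) : ℤ) by omega, zpow_sub₀ u0]
    simp [div_eq_mul_inv]
  rw [α, ← hn, ← this]
  ring

/-- Each of the n - 1 indices j ≠ k contributes u⁻² through p q = u². Independence of the ratio from
k is what lets L⁺ and L⁻ be treated together. -/
theorem β_eq (k : Fin n) : P.β k = (P.u ^ 2)⁻¹ * P.α k := by
  have u0 := P.u_ne_zero
  have h1 : ∏ j : Fin n with j < k, (P.p j k)⁻¹
      = (∏ j : Fin n with j < k, (P.u ^ 2)⁻¹) * ∏ j with j < k, P.q j k := by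
    rw [← Finset.prod_mul_distrib]
    refine Finset.prod_congr rfl fun j hj => ?_
    have := P.p_mul_q j k (Finset.mem_filter.1 hj).2
    have := P.p_ne j k
    have := P.q_ne j k
    rw [← P.p_mul_q j k (Finset.mem_filter.1 hj).2]
    field_simp
  have h2 : ∏ j : Fin n with k < j, (P.q k j)⁻¹
      = (∏ j : Fin n with k < j, (P.u ^ 2)⁻¹) * ∏ j with k < j, P.p k j := by
    rw [← Finset.prod_mul_distrib]
    refine Finset.prod_congr rfl fun j hj => ?_
    have := P.p_ne k j
    have := P.q_ne k j
    rw [← P.p_mul_q k j (Finset.mem_filter.1 hj).2]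
    field_simp
  have h3 := prod_lt_mul_prod_gt (P.u ^ 2)⁻¹ k
  have hn : P.u ^ ((n : ℤ) - 2) * (P.u ^ 2)⁻¹ ^ (n - 1)
      = (P.u ^ 2)⁻¹ * P.u ^ (2 - (n : ℤ)) := by
    have : 0 < n := k.pos
    rw [← zpow_natCast, ← zpow_natCast, ← zpow_neg, ← zpow_mul, ← zpow_add₀ u0, ← zpow_add₀ u0]
    congr 1
    push_cast [this]
    omega
  rw [β, α, h1, h2, ← mul_assoc _ (P.u ^ _ * _), ← mul_assoc _ (P.u ^ _), ← hn, ← h3]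
  ring

/-- Opposite diagonal coefficients of R are mutually inverse, so this differs from `prod_rDiag` only
at i = k, where u is replaced by u⁻¹. -/
theorem prod_rDiag_inv (k : Fin n) : ∏ i, (P.rDiag k i)⁻¹ = P.β k := by
  have u0 := P.u_ne_zero
  rw [β_eq, ← prod_rDiag, eq_inv_mul_iff_mul_eq₀ (pow_ne_zero 2 u0)]
  have : ∀ i, (P.rDiag k i)⁻¹ = (if i = k then (P.u ^ 2)⁻¹ else 1) * P.rDiag i k := by
    intro i
    by_cases h : i = k
    · subst h; rw [rDiag_self, if_pos rfl]; field_simp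
    · rw [if_neg h, one_mul]
      exact inv_eq_of_mul_eq_one_right (P.rDiag_mul k i (Ne.symm h))
  simp only [this, Finset.prod_mul_distrib]
  simp [u0]

theorem pairPlus_T (i j : Fin n) : P.pairPlus (P.T i j) = block P.Rplus i j := P.lift_T _ _ _ i j

theorem pairMinus_T (i j : Fin n) : P.pairMinus (P.T i j) = block P.Rminus i j :=
  P.lift_T _ _ _ i j

theorem pairPlus_det : P.pairPlus (rdet P.q P.T) = Matrix.diagonal P.α := by
  have e : P.T.map P.pairPlus = block P.Rplus := by ext1 i j; exact P.pairPlus_T i j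
  rw [map_rdet, e]
  ext a b
  by_cases h : a = b
  · subst h
    obtain ⟨-, t2⟩ := rdet_tri (fun a b : Fin n => b < a) (fun a b c h => by omega)
      (fun a c h => by omega) (fun a => lt_irrefl a) P.q (block P.Rplus)
      (fun i j a b h => by
        simp only [block, Rplus, R, Matrix.submatrix_apply, Prod.swap_prod_mk, Prod.mk.injEq]
        grind)
      (fun i j a h => by
        simp only [block, Rplus, R, Matrix.submatrix_apply, Prod.swap_prod_mk, Prod.mk.injEq]
        grind)
    rw [t2, Matrix.diagonal_apply_eq, ← prod_rDiag]
    simp [block, Rplus, R]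
  · rw [Matrix.diagonal_apply_ne _ h]
    refine rdet_block_off_diagonal _ _ (fun a b h1 h2 => ?_) h
    exact P.R_eq_zero _ _ (fun e => h1 (Prod.swap_injective e))
      (fun e => h2 (by simpa using congrArg Prod.swap e))

theorem pairMinus_det : P.pairMinus (rdet P.q P.T) = Matrix.diagonal P.β := by
  have e : P.T.map P.pairMinus = block P.Rminus := by ext1 i j; exact P.pairMinus_T i j
  rw [map_rdet, e]
  ext a b
  by_cases h : a = b
  · subst h
    obtain ⟨-, t2⟩ := rdet_tri (fun a b : Fin n => a < b) (fun a b c h => by omega)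
      (fun a c h => by omega) (fun a => lt_irrefl a) P.q (block P.Rminus)
      (fun i j a b h => by
        simp only [block, Rminus_apply, Prod.swap_prod_mk, Prod.mk.injEq]
        grind)
      (fun i j a h => by
        simp only [block, Rminus_apply, Prod.swap_prod_mk, Prod.mk.injEq]
        grind)
    rw [t2, Matrix.diagonal_apply_eq, ← prod_rDiag_inv]
    simp [block, Rminus_apply]
  · rw [Matrix.diagonal_apply_ne _ h]
    refine rdet_block_off_diagonal _ _ (fun a b h1 h2 => ?_) h
    simp [Rminus_apply, h1, h2]

/-! ### Iterated sums weighted by functions on words -/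

/-- `∑_g f(g₁ ⋯ g_r) X_{b₁ g₁} ⋯ X_{b_r g_r}` for a word `b₁ ⋯ b_r`, as a linear function of
the weight `f`. -/
noncomputable def iterSum (X : Matrix (Fin n) (Fin n) A) :
    List (Fin n) → (List (Fin n) → ℂ) →ₗ[ℂ] A
  | [] => (LinearMap.proj []).smulRight (1 : A)
  | b :: bs => ∑ g, LinearMap.mulLeft ℂ (X b g) ∘ₗ iterSum X bs ∘ₗ
      LinearMap.funLeft ℂ ℂ (List.cons g)

theorem iterSum_nil (X : Matrix (Fin n) (Fin n) A) (f : List (Fin n) → ℂ) :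
    iterSum X [] f = f [] • (1 : A) := rfl

theorem iterSum_cons (X : Matrix (Fin n) (Fin n) A) (b : Fin n) (bs : List (Fin n))
    (f : List (Fin n) → ℂ) :
    iterSum X (b :: bs) f = ∑ g, X b g * iterSum X bs fun l => f (g :: l) := by
  simp only [iterSum, LinearMap.sum_apply, LinearMap.comp_apply, LinearMap.mulLeft_apply]
  rfl

/-- Each new operator enters on the left of its word but leaves an entry of S(T) on the right, so
both ends must be accessible. -/
theorem iterSum_concat (X : Matrix (Fin n) (Fin n) A) (i : Fin n) (bs : List (Fin n)) :
    ∀ f : List (Fin n) → ℂ,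
    iterSum X (bs ++ [i]) f = ∑ k, (iterSum X bs fun l => f (l ++ [k])) * X i k := by
  induction bs with
  | nil => intro f; simp [iterSum_cons, iterSum_nil]
  | cons b bs ih =>
    intro f
    simp only [List.cons_append, iterSum_cons, ih, Finset.sum_mul, Finset.mul_sum, mul_assoc]
    rw [Finset.sum_comm]

theorem iterSum_ofFn (X : Matrix (Fin n) (Fin n) A) : ∀ {m : ℕ} (b : Fin m → Fin n)
    (f : List (Fin n) → ℂ), iterSum X (List.ofFn b) f
      = ∑ k : Fin m → Fin n, f (List.ofFn k) • (List.ofFn fun i => X (b i) (k i)).prod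
  | 0, b, f => by simp [iterSum_nil]
  | m + 1, b, f => by
    rw [List.ofFn_succ, iterSum_cons]
    simp only [iterSum_ofFn X (fun i => b i.succ), Finset.mul_sum]
    rw [← Fintype.sum_prod_type', ← (Fin.consEquiv (fun _ => Fin n)).sum_comp]
    refine Finset.sum_congr rfl fun a _ => ?_
    simp [List.ofFn_succ, Fin.consEquiv]

/-- A function on words is alternating with respect to `w` if exchanging two adjacent letters
`a b` changes it by the ratio of `w b a` and `w a b`. -/
def IsAlternating (w : Fin n → Fin n → ℂ) (f : List (Fin n) → ℂ) : Prop :=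
  ∀ l t, ∃ c : Fin n → Fin n → ℂ, (∀ a b, c a b = c b a) ∧
    ∀ a b, f (l ++ a :: b :: t) = w a b * c a b

theorem IsAlternating.cons {w : Fin n → Fin n → ℂ} {f : List (Fin n) → ℂ}
    (hf : IsAlternating w f) (g : Fin n) : IsAlternating w fun l => f (g :: l) :=
  fun l t => hf (g :: l) t

theorem IsAlternating.mul_prod {w : Fin n → Fin n → ℂ} {f : List (Fin n) → ℂ}
    (hf : IsAlternating w f) (d : Fin n → ℂ) (s : ℕ) :
    IsAlternating w fun l => f l * (l.map d).prod ^ s := by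
  intro l t
  obtain ⟨c, hc, h⟩ := hf l t
  refine ⟨fun a b => c a b * ((l ++ a :: b :: t).map d).prod ^ s, fun a b => ?_, fun a b => ?_⟩
  · simp only [hc a b, List.map_append, List.map_cons, List.prod_append, List.prod_cons]
    ring
  · simp only [h]; ring

/-- The product of `w` over all pairs of letters of a word. -/
def pairProd (w : Fin n → Fin n → ℂ) : List (Fin n) → ℂ
  | [] => 1
  | a :: l => (l.map (w a)).prod * pairProd w l

/-- Only the factor of the adjacent pair itself sees the order of its two letters. -/
theorem isAlternating_pairProd (w : Fin n → Fin n → ℂ) : IsAlternating w (pairProd w) := by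
  intro l t
  induction l with
  | nil =>
    refine ⟨fun a b => (t.map (w a)).prod * (t.map (w b)).prod * pairProd w t,
      fun a b => by ring, fun a b => ?_⟩
    simp only [List.nil_append, pairProd, List.map_cons, List.prod_cons]
    ring
  | cons x l ih =>
    obtain ⟨c, hc, h⟩ := ih
    refine ⟨fun a b => ((l ++ a :: b :: t).map (w x)).prod * c a b, fun a b => ?_, fun a b => ?_⟩
    · simp only [hc a b, List.map_append, List.map_cons, List.prod_append, List.prod_cons]
      ring
    · simp only [List.cons_append, pairProd, h]
      ring

theorem pairProd_ofFn (w : Fin n → Fin n → ℂ) : ∀ {m : ℕ} (k : Fin m → Fin n),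
    pairProd w (List.ofFn k) = ∏ ij : Fin m × Fin m with ij.1 < ij.2, w (k ij.1) (k ij.2)
  | 0, k => by simp [pairProd]
  | m + 1, k => by
    rw [List.ofFn_succ, pairProd, pairProd_ofFn w, Finset.prod_filter, Finset.prod_filter,
      Fintype.prod_prod_type, Fintype.prod_prod_type, Fin.prod_univ_succ]
    congr 1
    · simp [Fin.prod_univ_succ, List.map_ofFn, List.prod_ofFn]
    · refine Finset.prod_congr rfl fun i _ => ?_
      simp [Fin.prod_univ_succ]

/-- A column of Y lives on the two orders of a pair of letters, where f is proportional to w; there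
`hY` is an eigenvector equation for Y followed by the flip. For equal letters both sides vanish. -/
theorem sum_alternating_mul {w : Fin n → Fin n → ℂ} {f : List (Fin n) → ℂ}
    (hf : IsAlternating w f) (hw : ∀ a, w a a = 0)
    (Y : Matrix (Fin n × Fin n) (Fin n × Fin n) ℂ) (c : ℂ)
    (hY0 : ∀ x y, x ≠ y → x ≠ y.swap → Y x y = 0)
    (hY : ∀ k h, k ≠ h → w k h * Y (k, h) (k, h) + w h k * Y (h, k) (k, h) = c * w h k)
    (l t : List (Fin n)) (k h : Fin n) :
    ∑ x : Fin n × Fin n, Y x (k, h) * f (l ++ x.1 :: x.2 :: t) = c * f (l ++ h :: k :: t) := by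
  obtain ⟨d, hd, e⟩ := hf l t
  simp only [e]
  by_cases hkh : k = h
  · subst hkh
    rw [hw, zero_mul, mul_zero]
    refine Finset.sum_eq_zero fun x _ => ?_
    by_cases hx : x = (k, k)
    · subst hx; simp [hw]
    · rw [hY0 x _ hx (by simpa using hx), zero_mul]
  · rw [← Finset.sum_subset (Finset.subset_univ {(k, h), (h, k)})]
    · rw [Finset.sum_pair (by simp [hkh])]
      linear_combination d h k * hY k h hkh + (Y (k, h) (k, h) * w k h) * hd k h
    · intro x _ hx
      simp only [Finset.mem_insert, Finset.mem_singleton, not_or] at hx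
      rw [hY0 x _ hx.1 (by simpa using hx.2), zero_mul]

/-- Commuting a group-like matrix past an alternating sum of products of entries of the
antipode. -/
theorem sum_apply_iterSum {w : Fin n → Fin n → ℂ} (hw : ∀ a, w a a = 0)
    (Y : Matrix (Fin n × Fin n) (Fin n × Fin n) ℂ) (c : ℂ)
    (hY0 : ∀ x y, x ≠ y → x ≠ y.swap → Y x y = 0)
    (hY : ∀ k h, k ≠ h → w k h * Y (k, h) (k, h) + w h k * Y (h, k) (k, h) = c * w h k)
    (S : Matrix (Fin n) (Fin n) A) (F : A →ₐ[ℂ] Matrix (Fin n) (Fin n) A)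
    (hF : ∀ a b k l, F (S a b) k l = ∑ c, Y (k, a) (l, c) • S c b) (bs : List (Fin n)) :
    ∀ f : List (Fin n) → ℂ, IsAlternating w f → ∀ k,
      ∑ a, F (iterSum S.transpose bs fun l => f (a :: l)) a k
        = c ^ bs.length • iterSum S.transpose bs fun l => f (l ++ [k]) := by
  induction bs with
  | nil =>
    intro f _ k
    -- On the empty word `F` is applied to a scalar, so only a = k survives.
    simp [iterSum_nil, Matrix.one_apply]
  | cons b bs ih =>
    intro f hf k
    -- The eigenvector relation for the first two letters, transported by linearity of `iterSum` in
    -- its weight: the travelling letter moves one place to the right at the cost of c.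
    have h1 : ∀ m d, ∑ x : Fin n × Fin n, Y x (m, d) •
        F (iterSum S.transpose bs fun l => f (x.1 :: x.2 :: l)) m k
          = c • F (iterSum S.transpose bs fun l => f (d :: m :: l)) m k := by
      intro m d
      have := congrArg (fun g => F (iterSum S.transpose bs g) m k)
        (funext fun l => sum_alternating_mul hf hw Y c hY0 hY [] l m d)
      have e1 : (fun l => ∑ x : Fin n × Fin n, Y x (m, d) * f ([] ++ x.1 :: x.2 :: l))
          = ∑ x : Fin n × Fin n, Y x (m, d) • fun l => f (x.1 :: x.2 :: l) := by
        ext l; simp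
      have e2 : (fun l => c * f ([] ++ d :: m :: l)) = c • fun l => f (d :: m :: l) := by
        ext l; simp
      simp only [e1, e2, map_sum, map_smul, Matrix.sum_apply, Matrix.smul_apply] at this
      exact this
    calc _ = ∑ x : Fin n × Fin n, ∑ y : Fin n × Fin n, S y.2 b * (Y x y •
          F (iterSum S.transpose bs fun l => f (x.1 :: x.2 :: l)) y.1 k) := by
          simp only [iterSum_cons, map_sum, map_mul, Matrix.sum_apply, Matrix.mul_apply,
            Matrix.transpose_apply, hF, Finset.sum_mul, Fintype.sum_prod_type, mul_smul_comm,
            smul_mul_assoc]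
      _ = ∑ y : Fin n × Fin n, S y.2 b *
          (c • F (iterSum S.transpose bs fun l => f (y.2 :: y.1 :: l)) y.1 k) := by
          rw [Finset.sum_comm]
          simp only [← Finset.mul_sum]
          exact Finset.sum_congr rfl fun y _ => by rw [h1]
      _ = ∑ d, S d b * (c • ∑ m, F (iterSum S.transpose bs fun l => f (d :: m :: l)) m k) := by
          rw [Fintype.sum_prod_type, Finset.sum_comm]
          simp only [Finset.smul_sum, Finset.mul_sum]
      _ = _ := by
          simp only [ih _ (hf.cons _) k, iterSum_cons, Finset.smul_sum, mul_smul_comm,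
            Matrix.transpose_apply, List.cons_append, smul_smul, List.length_cons, pow_succ']

/-! ### The differential operators on powers of the determinant -/

/-- The parameters `u⁻¹, q_{ij}⁻¹, p_{ij}⁻¹`. -/
noncomputable def inverse : MultiParam n where
  u := P.u⁻¹
  p i j := (P.q i j)⁻¹
  q i j := (P.p i j)⁻¹
  u_ne_zero := inv_ne_zero P.u_ne_zero
  u_sq_ne h := P.u_sq_ne (by rw [← inv_inj, ← inv_pow, h, inv_neg, inv_one])
  p_mul_q i j h := by rw [← mul_inv, mul_comm, P.p_mul_q i j h, inv_pow]
  p_mul_p i j := by rw [← mul_inv, P.q_mul_q, inv_one]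
  q_mul_q i j := by rw [← mul_inv, P.p_mul_p, inv_one]
  p_self i := by rw [P.q_self, inv_one]
  q_self i := by rw [P.p_self, inv_one]

/-! ### Alternating weights as eigenvectors of the R-matrix -/

theorem wt_self (a : Fin n) : P.wt a a = 0 := by simp [wt]

theorem wt_inverse (a b : Fin n) :
    P.inverse.wt a b = if a < b then 1 else if b < a then -(P.p b a)⁻¹ else 0 := rfl

/-- The alternating vector lies in the -u⁻¹ eigenspace of the braiding attached to R; this is the
relation for L⁻, since (R⁻)⁻¹ = R. -/
theorem wt_mul_R {k h : Fin n} (hkh : k ≠ h) :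
    P.inverse.wt k h * P.R (k, h) (k, h) + P.inverse.wt h k * P.R (h, k) (k, h)
      = -P.u⁻¹ * P.inverse.wt h k := by
  have u0 := P.u_ne_zero
  rcases lt_or_gt_of_ne hkh with hlt | hlt
  · have := P.p_ne k h
    have hq : P.q k h = P.u ^ 2 / P.p k h := by rw [← P.p_mul_q _ _ hlt]; field_simp
    simp [wt_inverse, R, rDiag, hlt, hlt.not_gt, hlt.ne, hlt.ne', hq]
    field_simp
    ring
  · have := P.p_ne h k
    simp [wt_inverse, R, rDiag, hlt, hlt.not_gt, hlt.ne, hlt.ne']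
    field_simp

/-- If R were singular, the matrix inverse would default to 0, contradicting the diagonal entry u⁻¹
computed in `Rminus_apply`. -/
theorem isUnit_det_R : IsUnit P.R.det := by
  by_contra h
  have h0 : P.Rminus = 0 := Matrix.nonsing_inv_apply_not_isUnit _ h
  cases n with
  | zero => simp at h
  | succ n =>
    have := P.Rminus_apply (0, 0) (0, 0)
    simp [h0, rDiag_self, eq_comm, P.u_ne_zero] at this

theorem R_mul_Rminus : P.R * P.Rminus = 1 := Matrix.mul_nonsing_inv _ P.isUnit_det_R

theorem Rminus_mul_R : P.Rminus * P.R = 1 := Matrix.nonsing_inv_mul _ P.isUnit_det_R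

theorem Rplus_mul_submatrix : P.Rplus * P.Rminus.submatrix Prod.swap Prod.swap = 1 := by
  have := Matrix.submatrix_mul_equiv P.R P.Rminus Prod.swap (Equiv.prodComm (Fin n) (Fin n))
    Prod.swap
  rw [R_mul_Rminus] at this
  rw [Rplus]
  refine this.trans ?_
  exact Matrix.submatrix_one_equiv (Equiv.prodComm (Fin n) (Fin n))

/-- The counterpart for L⁺: (R⁺)⁻¹ is the flipped R⁻¹, whence the inverse eigenvalue -u. -/
theorem wt_mul_Rplus_inv {k h : Fin n} (hkh : k ≠ h) :
    P.inverse.wt k h * P.Rminus.submatrix Prod.swap Prod.swap (k, h) (k, h)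
      + P.inverse.wt h k * P.Rminus.submatrix Prod.swap Prod.swap (h, k) (k, h)
      = -P.u * P.inverse.wt h k := by
  have u0 := P.u_ne_zero
  rcases lt_or_gt_of_ne hkh with hlt | hlt
  · have := P.p_ne k h
    simp [wt_inverse, Rminus_apply, rDiag, hlt, hlt.not_gt, hlt.ne, hlt.ne']
    field_simp
  · have := P.p_ne h k
    have hq : P.q h k = P.u ^ 2 / P.p h k := by rw [← P.p_mul_q _ _ hlt]; field_simp
    simp [wt_inverse, Rminus_apply, rDiag, hlt, hlt.not_gt, hlt.ne, hlt.ne', hq]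
    field_simp
    ring

theorem Rminus_eq_zero (a b : Fin n × Fin n) (h1 : a ≠ b) (h2 : a ≠ b.swap) :
    P.Rminus a b = 0 := by
  simp [Rminus_apply, h1, h2]

/-- The left action of a group-like matrix on `det^s` times an alternating sum. -/
theorem sum_coaction_det_mul (F : P.QGL →ₐ[ℂ] Matrix (Fin n) (Fin n) ℂ)
    (X Y : Matrix (Fin n × Fin n) (Fin n × Fin n) ℂ) (hXY : X * Y = 1)
    (hX : ∀ i j, F (P.T i j) = block X i j) (c e : ℂ)
    (hF : F (rdet P.q P.T) = Matrix.diagonal fun i => e * P.α i)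
    (hY0 : ∀ x y, x ≠ y → x ≠ y.swap → Y x y = 0)
    (hY : ∀ k h, k ≠ h → P.inverse.wt k h * Y (k, h) (k, h)
      + P.inverse.wt h k * Y (h, k) (k, h) = c * P.inverse.wt h k)
    (f : List (Fin n) → ℂ) (hf : IsAlternating P.inverse.wt f) (s : ℕ) (bs : List (Fin n))
    (k : Fin n) :
    ∑ a, P.coaction F (rdet P.q P.T ^ s * iterSum P.antipodeT.transpose bs
        fun l => f (a :: l) * (l.map P.α).prod ^ s) a k
      = (e ^ s * c ^ bs.length) • (rdet P.q P.T ^ s * iterSum P.antipodeT.transpose bs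
        fun l => f (l ++ [k]) * ((l ++ [k]).map P.α).prod ^ s) := by
  have key := sum_apply_iterSum P.inverse.wt_self Y c hY0 hY P.antipodeT (P.coaction F)
    (P.coaction_antipodeT F X Y hXY hX) bs _ (hf.mul_prod P.α s) k
  rw [mul_smul, ← mul_smul_comm (c ^ _), ← key, Finset.mul_sum, Finset.smul_sum]
  refine Finset.sum_congr rfl fun a _ => ?_
  -- The factor α_a^s coming from det^s completes the product over l to the symmetric product over
  -- the whole word, so the weight is alternating.
  have e1 : (fun l => f (a :: l) * ((a :: l).map P.α).prod ^ s)
      = P.α a ^ s • fun l => f (a :: l) * (l.map P.α).prod ^ s := by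
    ext l
    simp only [List.map_cons, List.prod_cons, Pi.smul_apply, smul_eq_mul]
    ring
  rw [map_mul, P.coaction_det_pow F _ hF, Matrix.diagonal_mul, e1]
  simp only [map_smul, Matrix.smul_apply, mul_smul_comm, smul_mul_assoc, smul_smul, mul_pow]

theorem Lop_apply (x : ℂ) (i j : Fin n) (φ : P.QGL) : P.Lop x i j φ
    = x • P.coaction P.pairPlus φ i j - x⁻¹ • P.coaction P.pairMinus φ i j := by
  rw [coaction_eq_act, coaction_eq_act]
  rfl

theorem del_apply (x : ℂ) (i j : Fin n) (φ : P.QGL) : P.del x i j φ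
    = (P.u - P.u⁻¹)⁻¹ • ∑ k, P.Lop x j k φ * P.antipodeT k i := by
  simp [del]

/-- Alternating sums of products of the operators `∂_ij(x)`, on powers of the determinant. -/
theorem iterSum_del (x : ℂ) (s : ℕ) (bs : List (Fin n)) :
    ∀ f : List (Fin n) → ℂ, IsAlternating P.inverse.wt f →
      iterSum (P.del x) bs f (rdet P.q P.T ^ s)
        = (∏ t ∈ Finset.range bs.length, (P.u - P.u⁻¹)⁻¹ *
            (x * (-P.u) ^ t - x⁻¹ * ((P.u ^ 2)⁻¹ ^ s * (-P.u⁻¹) ^ t))) •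
          (rdet P.q P.T ^ s * iterSum P.antipodeT.transpose bs.reverse
            fun l => f l * (l.map P.α).prod ^ s) := by
  induction bs with
  | nil => intro f _; simp [iterSum_nil]
  | cons i bs ih =>
    intro f hf
    -- For L⁺ the determinant has values α_k, so e = 1; for L⁻ they are β_k, so e = u⁻².
    have hp := fun k => P.sum_coaction_det_mul P.pairPlus P.Rplus _ P.Rplus_mul_submatrix
      P.pairPlus_T (-P.u) 1 (by simp [pairPlus_det])
      (fun a b h1 h2 => P.Rminus_eq_zero _ _ (fun e => h1 (Prod.swap_injective e))
        (fun e => h2 (Prod.swap_injective e)))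
      (fun k h => P.wt_mul_Rplus_inv) f hf s bs.reverse k
    have hm := fun k => P.sum_coaction_det_mul P.pairMinus P.Rminus P.R P.Rminus_mul_R
      P.pairMinus_T (-P.u⁻¹) (P.u ^ 2)⁻¹
      (P.pairMinus_det.trans (congrArg Matrix.diagonal (funext P.β_eq)))
      P.R_eq_zero (fun k h => P.wt_mul_R) f hf s bs.reverse k
    -- The leftmost operator acts last, after `bs.length` others; its factor S(t_ki) is appended on
    -- the right, which reverses the word.
    rw [iterSum_cons, LinearMap.sum_apply, List.length_cons, Finset.prod_range_succ,
      List.reverse_cons, iterSum_concat]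
    simp only [Module.End.mul_apply, ih _ (hf.cons _), map_smul, del_apply, ← Finset.smul_sum]
    rw [Finset.sum_comm, mul_smul, mul_smul]
    congr 2
    rw [Finset.mul_sum, Finset.smul_sum]
    refine Finset.sum_congr rfl fun k _ => ?_
    rw [← Finset.sum_mul]
    simp only [Lop_apply, Finset.sum_sub_distrib, ← Finset.smul_sum, hp, hm, one_pow, one_mul,
      List.length_reverse, smul_smul, ← sub_smul, smul_mul_assoc, mul_assoc,
      Matrix.transpose_apply]

/-! ### Determinants as alternating sums -/

theorem sum_eq_sum_perm {M : Type*} [AddCommMonoid M] (F : (Fin n → Fin n) → M)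
    (hF : ∀ k, ¬ Function.Injective k → F k = 0) :
    ∑ k, F k = ∑ σ : Equiv.Perm (Fin n), F σ := by
  symm
  refine Finset.sum_of_injOn (fun σ : Equiv.Perm (Fin n) => (σ : Fin n → Fin n)) ?_ (by simp) ?_
    (fun _ _ => rfl)
  · exact fun _ _ _ _ h => DFunLike.coe_injective h
  · intro k _ hk
    refine hF k fun hi => hk ?_
    exact Set.mem_image_of_mem _
      (x := Equiv.ofBijective k (Finite.injective_iff_bijective.1 hi)) (by simp)

theorem pairProd_wt_ofFn (k : Fin n → Fin n) : pairProd P.wt (List.ofFn k) = P.wtSeq k :=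
  pairProd_ofFn _ _

theorem rdet_eq_iterSum (X : Matrix (Fin n) (Fin n) A) :
    rdet P.q X = iterSum X (List.ofFn id) (pairProd P.wt) := by
  rw [iterSum_ofFn, sum_eq_sum_perm]
  · simp only [pairProd_wt_ofFn, wtSeq_perm]
    rfl
  · intro k hk
    rw [pairProd_wt_ofFn, P.wtSeq_eq_zero hk, zero_smul]

/-- Because the second product is reversed, matching factors are nested and T S = 1 collapses them
from the inside out. -/
theorem sum_prod_mul_reverse_prod {A : Type*} [Ring A] {T S : Matrix (Fin n) (Fin n) A} (h : T * S = 1) :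
    ∀ {m : ℕ} (a b : Fin m → Fin n),
    ∑ k : Fin m → Fin n, (List.ofFn fun i => T (a i) (k i)).prod *
      (List.ofFn fun i => S (k i) (b i)).reverse.prod = if a = b then 1 else 0
  | 0, a, b => by simp [Subsingleton.elim a b]
  | m + 1, a, b => by
    rw [← (Fin.consEquiv (fun _ => Fin n)).sum_comp, Fintype.sum_prod_type]
    have ih := sum_prod_mul_reverse_prod h (fun i => a i.succ) (fun i => b i.succ)
    have h0 := congrFun (congrFun h (a 0)) (b 0)
    rw [Matrix.mul_apply] at h0
    calc _ = ∑ x, T (a 0) x * (∑ k : Fin m → Fin n, (List.ofFn fun i => T (a i.succ) (k i)).prod *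
            (List.ofFn fun i => S (k i) (b i.succ)).reverse.prod) * S x (b 0) := by
          refine Finset.sum_congr rfl fun x _ => ?_
          rw [Finset.mul_sum, Finset.sum_mul]
          refine Finset.sum_congr rfl fun k _ => ?_
          simp [List.ofFn_succ, Fin.consEquiv, mul_assoc]
      _ = _ := by
          rw [ih]
          by_cases hs : (fun i : Fin m => a i.succ) = fun i => b i.succ
          · simp only [hs, if_true, mul_one, h0, Matrix.one_apply]
            congr 1
            rw [eq_iff_iff]
            refine ⟨fun e => funext fun i => Fin.cases e (fun i => congrFun hs i) i,
              fun e => congrFun e 0⟩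
          · have : a ≠ b := fun e => hs (by rw [e])
            simp [hs, this]

/-- The reversed column determinant of the inverse matrix is inverse to the determinant. -/
theorem cdet_mul_sum_reverse {T S : Matrix (Fin n) (Fin n) A} (hT : P.rttL T = P.rttR T)
    (h : T * S = 1) :
    cdet P.p T * ∑ k : Fin n → Fin n, P.flip.wtSeq k •
      (List.ofFn fun i => S (k i) i).reverse.prod = 1 := by
  have h1 := P.flip.rowDet_eq _ (P.rtt_transpose hT)
  -- The weight times the determinant is the column determinant with columns k; in the sum over k
  -- only σ = 1 then survives the telescoping.
  have h2 : ∀ k : Fin n → Fin n, P.flip.wtSeq k • cdet P.p T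
      = ∑ σ : Equiv.Perm (Fin n), qSign P.p σ • (List.ofFn fun i => T (σ i) (k i)).prod :=
    fun k => (h1 k).symm
  simp only [Finset.mul_sum, mul_smul_comm, ← smul_mul_assoc, h2, Finset.sum_mul]
  rw [Finset.sum_comm]
  simp only [smul_mul_assoc, ← Finset.smul_sum]
  rw [Finset.sum_eq_single 1]
  · rw [sum_prod_mul_reverse_prod h (fun i => (1 : Equiv.Perm (Fin n)) i) (fun i => i)]
    simp [qSign_one]
  · intro σ _ hσ
    rw [sum_prod_mul_reverse_prod h (fun i => σ i) (fun i => i), if_neg, smul_zero]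
    exact fun e => hσ (Equiv.ext fun i => congrFun e i)
  · simp

/-! ### Reversal of words -/

theorem reverse_ofFn {α : Type*} {m : ℕ} (f : Fin m → α) :
    (List.ofFn f).reverse = List.ofFn (f ∘ Fin.rev) := by
  apply List.ext_getElem
  · simp
  · intro i h1 h2
    simp only [List.length_reverse, List.length_ofFn] at h1
    simp only [List.getElem_reverse, List.getElem_ofFn, List.length_ofFn, Function.comp_apply]
    congr 1
    ext
    simp only [Fin.val_rev]
    omega

/-- σ permutes the unordered pairs, represented here by (min, max). -/
theorem prod_pairs_perm (v : Fin n → Fin n → ℂ) (hv : ∀ a b, v a b = v b a)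
    (σ : Equiv.Perm (Fin n)) :
    ∏ ij : Fin n × Fin n with ij.1 < ij.2, v (σ ij.1) (σ ij.2)
      = ∏ ij : Fin n × Fin n with ij.1 < ij.2, v ij.1 ij.2 := by
  have hm : ∀ (τ : Equiv.Perm (Fin n)) (ij : Fin n × Fin n), ij.1 < ij.2 →
      min (τ ij.1) (τ ij.2) < max (τ ij.1) (τ ij.2) := fun τ ij h =>
    min_lt_max.2 fun e => h.ne (τ.injective e)
  have hi : ∀ (τ : Equiv.Perm (Fin n)) (ij : Fin n × Fin n), ij.1 < ij.2 →
      (min (τ⁻¹ (min (τ ij.1) (τ ij.2))) (τ⁻¹ (max (τ ij.1) (τ ij.2))),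
        max (τ⁻¹ (min (τ ij.1) (τ ij.2))) (τ⁻¹ (max (τ ij.1) (τ ij.2)))) = ij := by
    intro τ ij h
    rcases le_total (τ ij.1) (τ ij.2) with h' | h' <;> simp [h', h.le]
  refine Finset.prod_bij' (fun ij _ => (min (σ ij.1) (σ ij.2), max (σ ij.1) (σ ij.2)))
    (fun ij _ => (min (σ⁻¹ ij.1) (σ⁻¹ ij.2), max (σ⁻¹ ij.1) (σ⁻¹ ij.2))) ?_ ?_ ?_ ?_ ?_
  · intro ij h
    simpa using hm σ ij (by simpa using h)
  · intro ij h
    simpa using hm σ⁻¹ ij (by simpa using h)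
  · intro ij h
    exact hi σ ij (by simpa using h)
  · intro ij h
    exact hi σ⁻¹ ij (by simpa using h)
  · intro ij _
    rcases le_total (σ ij.1) (σ ij.2) with h' | h'
    · simp [h']
    · simp [h', hv (σ ij.1)]

/-- Reversal exchanges the letters of every pair, and for one pair the two weights differ by a
factor symmetric in the letters. For injective k the product of these factors does not depend on k;
otherwise both sides vanish. -/
theorem wtSeq_rev (k : Fin n → Fin n) : P.inverse.wtSeq (k ∘ Fin.rev)
    = (∏ ij : Fin n × Fin n with ij.1 < ij.2, -(P.p ij.1 ij.2)⁻¹) * P.flip.wtSeq k := by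
  by_cases hk : Function.Injective k
  · let v : Fin n → Fin n → ℂ := fun a b => if a < b then -(P.p a b)⁻¹ else -(P.p b a)⁻¹
    have hv : ∀ a b, v a b = v b a := fun a b => by
      rcases lt_trichotomy a b with h | h | h
      · simp [v, h, h.not_gt]
      · rw [h]
      · simp [v, h, h.not_gt]
    have h1 := prod_pairs_perm v hv (Equiv.ofBijective k (Finite.injective_iff_bijective.1 hk))
    have h2 : ∏ ij : Fin n × Fin n with ij.1 < ij.2, -(P.p ij.1 ij.2)⁻¹
        = ∏ ij : Fin n × Fin n with ij.1 < ij.2, v ij.1 ij.2 :=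
      Finset.prod_congr rfl fun ij h => by simp [v, (Finset.mem_filter.1 h).2]
    rw [h2, ← h1, wtSeq, wtSeq, ← Finset.prod_mul_distrib]
    refine Finset.prod_equiv ((Equiv.prodComm _ _).trans (Equiv.prodCongr Fin.revPerm Fin.revPerm))
      (by simp) fun ij _ => ?_
    have hf : ∀ a b, P.flip.wt a b = if a < b then 1 else if b < a then -P.p b a else 0 :=
      fun _ _ => rfl
    have hw : ∀ a b, P.inverse.wt b a = v a b * P.flip.wt a b := by
      intro a b
      have := P.p_ne b a
      rcases lt_trichotomy a b with h | h | h
      · simp [wt_inverse, hf, v, h, h.not_gt]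
      · subst h; simp [wt_inverse, hf]
      · simp [wt_inverse, hf, v, h, h.not_gt, this]
    simp [hw]
  · rw [P.flip.wtSeq_eq_zero hk, mul_zero]
    refine P.inverse.wtSeq_eq_zero fun h => hk ?_
    simpa [Function.comp_assoc, Fin.rev_involutive.comp_self] using h.comp Fin.rev_injective

/-- The alternating sum of products of entries of the antipode in reversed order. -/
theorem iterSum_antipodeT (s : ℕ) :
    (iterSum P.antipodeT.transpose (List.ofFn (id : Fin n → Fin n)).reverse fun l =>
      pairProd P.inverse.wt l * (l.map P.α).prod ^ s)
      = ((∏ ij : Fin n × Fin n with ij.1 < ij.2, -(P.p ij.1 ij.2)⁻¹) * ∏ i, P.α i ^ s) •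
        ((P.detUnit⁻¹ : P.QGLˣ) : P.QGL) := by
  have hdet : cdet P.p P.T = P.detUnit := P.cdet_eq_rdet P.T_rtt
  have h := P.cdet_mul_sum_reverse P.T_rtt P.T_mul_antipodeT
  rw [hdet] at h
  rw [← Units.eq_inv_of_mul_eq_one_left h]
  have hr : (List.ofFn (id : Fin n → Fin n)).reverse = List.ofFn Fin.rev := by
    rw [reverse_ofFn]; rfl
  -- Reindexing by k ↦ k ∘ `Fin.rev` turns the reversed word into the reversed product of
  -- `cdet_mul_sum_reverse`.
  rw [hr, iterSum_ofFn, Finset.smul_sum,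
    ← Equiv.sum_comp ((Equiv.arrowCongr Fin.revPerm (Equiv.refl (Fin n))))]
  refine Finset.sum_congr rfl fun k _ => ?_
  have hk : (Equiv.arrowCongr Fin.revPerm (Equiv.refl (Fin n))) k = k ∘ Fin.rev := rfl
  rw [hk, pairProd_wt_ofFn, wtSeq_rev, smul_smul]
  have hl : (List.ofFn fun i => P.antipodeT.transpose (Fin.rev i) ((k ∘ Fin.rev) i))
      = (List.ofFn fun i => P.antipodeT (k i) i).reverse := by
    rw [reverse_ofFn]; rfl
  rw [hl]
  by_cases hi : Function.Injective k
  · congr 1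
    have : ((List.ofFn (k ∘ Fin.rev)).map P.α).prod = ∏ i, P.α i := by
      rw [List.map_ofFn, List.prod_ofFn]
      exact Function.Bijective.prod_comp (Finite.injective_iff_bijective.1
        (hi.comp Fin.rev_injective)) P.α
    rw [this, Finset.prod_pow]
    ring
  · simp [P.flip.wtSeq_eq_zero hi]

/-- There are t pairs whose larger element has index t, so both products carry the sign
(-1)^(n(n-1)/2). -/
theorem prod_neg_one_pairs :
    (∏ t ∈ Finset.range n, (-1 : ℂ) ^ t) *
      ∏ ij : Fin n × Fin n with ij.1 < ij.2, (-1 : ℂ) = 1 := by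
  have : ∏ ij : Fin n × Fin n with ij.1 < ij.2, (-1 : ℂ) = ∏ t ∈ Finset.range n, (-1 : ℂ) ^ t := by
    rw [Finset.prod_filter, Fintype.prod_prod_type_right, ← Fin.prod_univ_eq_prod_range]
    refine Finset.prod_congr rfl fun j _ => ?_
    rw [← Finset.prod_filter, Finset.prod_const, Finset.filter_gt_eq_Iio, Fin.card_Iio]
  rw [this, ← Finset.prod_mul_distrib]
  exact Finset.prod_eq_one fun t _ => by rw [← mul_pow]; simp

end MultiParam

/-! ### Assembling the scalars -/

theorem corollary4p7 {n : ℕ} (P : MultiParam n) (hu : P.u ^ 2 ≠ 1) (x : ℂ) (hx : x ≠ 0) (s : ℕ) :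
    rdet (fun i j => (P.p i j)⁻¹) (P.del x) (cdet P.p P.T ^ s)
      = (((P.u - P.u⁻¹) ^ n)⁻¹
          * (∏ ij : Fin n × Fin n with ij.1 < ij.2, (P.p ij.1 ij.2)⁻¹)
          * ∏ i : Fin n, P.γ i s (x * P.u ^ (n - (i.val + 1))))
        • ((P.detUnit ^ ((s : ℤ) - 1) : P.QGLˣ) : P.QGL) := by
  have h1 : rdet (fun i j => (P.p i j)⁻¹) (P.del x)
      = MultiParam.iterSum (P.del x) (List.ofFn id) (MultiParam.pairProd P.inverse.wt) :=
    P.inverse.rdet_eq_iterSum (P.del x)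
  have hdet : rdet P.q P.T = P.detUnit := rfl
  rw [h1, P.cdet_eq_rdet P.T_rtt, P.iterSum_del x s _ _ (MultiParam.isAlternating_pairProd _),
    P.iterSum_antipodeT, mul_smul_comm, smul_smul, hdet, List.length_ofFn, zpow_sub_one,
    zpow_natCast, Units.val_mul, Units.val_pow_eq_pow_val]
  congr 1
  -- By β_i = u⁻² α_i each γ factor is α_i^s times a scalar depending only on the exponent. With i
  -- counted from 0, factor i corresponds to the step t = n - 1 - i, hence the reflection of the
  -- range.
  have hγ : ∏ i : Fin n, P.γ i s (x * P.u ^ (n - (i.val + 1)))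
      = (∏ t ∈ Finset.range n, (x * P.u ^ t - x⁻¹ * ((P.u ^ 2)⁻¹ ^ s * P.u⁻¹ ^ t))) *
        ∏ i, P.α i ^ s := by
    rw [← Finset.prod_range_reflect, ← Fin.prod_univ_eq_prod_range
      (fun j => x * P.u ^ (n - 1 - j) - x⁻¹ * ((P.u ^ 2)⁻¹ ^ s * P.u⁻¹ ^ (n - 1 - j))),
      ← Finset.prod_mul_distrib]
    refine Finset.prod_congr rfl fun i _ => ?_
    rw [MultiParam.γ, P.β_eq, show n - 1 - (i : ℕ) = n - (i + 1) by omega, mul_inv, inv_pow P.u,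
      mul_pow]
    ring
  have hK : ∏ t ∈ Finset.range n, ((P.u - P.u⁻¹)⁻¹ *
      (x * (-P.u) ^ t - x⁻¹ * ((P.u ^ 2)⁻¹ ^ s * (-P.u⁻¹) ^ t)))
      = ((P.u - P.u⁻¹) ^ n)⁻¹ * ((∏ t ∈ Finset.range n, (-1 : ℂ) ^ t) *
        ∏ t ∈ Finset.range n, (x * P.u ^ t - x⁻¹ * ((P.u ^ 2)⁻¹ ^ s * P.u⁻¹ ^ t))) := by
    rw [Finset.prod_mul_distrib, Finset.prod_const, Finset.card_range, inv_pow,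
      ← Finset.prod_mul_distrib]
    congr 1
    refine Finset.prod_congr rfl fun t _ => ?_
    rw [neg_pow P.u, neg_pow P.u⁻¹]
    ring
  have hV : ∏ ij : Fin n × Fin n with ij.1 < ij.2, -(P.p ij.1 ij.2)⁻¹
      = (∏ ij : Fin n × Fin n with ij.1 < ij.2, (-1 : ℂ)) *
        ∏ ij : Fin n × Fin n with ij.1 < ij.2, (P.p ij.1 ij.2)⁻¹ := by
    rw [← Finset.prod_mul_distrib]
    simp
  rw [hγ, hK, hV]
  have := MultiParam.prod_neg_one_pairs (n := n)
  linear_combination (((P.u - P.u⁻¹) ^ n)⁻¹ *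
    (∏ t ∈ Finset.range n, (x * P.u ^ t - x⁻¹ * ((P.u ^ 2)⁻¹ ^ s * P.u⁻¹ ^ t))) *
    (∏ ij : Fin n × Fin n with ij.1 < ij.2, (P.p ij.1 ij.2)⁻¹) * ∏ i, P.α i ^ s) * this
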